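/- **Setting.** Let $\mathfrak K$ be a separable complex Hilbert space and $\mathfrak H=\mathfrak K\otimes L^2(0,\infty)=L^2((0,\infty);\mathfrak K)$. Let $\Lambda:\mathfrak B(\mathfrak K)\to\mathfrak B(\mathfrak H)$, $(\Lambda(A)f)(x)=e^{-x}Af(x)$, and write $\Lambda=\Lambda(I)$. For $t>0$ let $E(t,\infty)\in\mathfrak B(\mathfrak H)$ be the projection onto functions supported in $(t,\infty)$. $\mathfrak B(\cdot)_*$ denotes the space of normal functionals, with the dual norm. *Boundary weights.* Let $\mathfrak A(\mathfrak H)=(I-\Lambda)^{1/2}\mathfrak B(\mathfrak H)(I-\Lambda)^{1/2}$. A boundary weight $\mu\in\mathfrak A(\mathfrak H)_*$ is a linear functional on $\mathfrak A(\mathfrak H)$ such that $A\mapsto\mu((I-\Lambda)^{1/2}A(I-\Lambda)^{1/2})$ is a normal bounded functional on $\mathfrak B(\mathfrak H)$; it is positive if $\mu(A)\ge 0$ for all positive $A\in\mathfrak A(\mathfrak H)$. Its truncations are the normal functionals $\mu|_t(A)=\mu(E(t,\infty)AE(t,\infty))$, $A\in\mathfrak B(\mathfrak H)$, $t>0$.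 If $\mu$ is positive, then for $A=\Lambda(e)$ with $e\ge0$, and for $A=I-\Lambda(T)$ with $0\le T\le I$, we put $\mu(A)=\lim_{t\to0+}\mu|_t(A)\in[0,\infty]$. For positive boundary weights, $\omega\ge_q\eta$ means that $$\frac{\omega|_t(A)}{1+\omega|_t(\Lambda)}\ \ge\ \frac{\eta|_t(A)}{1+\eta|_t(\Lambda)}\qquad\text{for all }t>0\text{ and all positive }A\in\mathfrak B(\mathfrak H),$$ and a positive boundary weight $\omega$ is *$q$-pure* if, for positive boundary weights $\eta$, one has $\omega\ge_q\eta\ge_q0$ if and only if $\eta=\lambda\omega$ for some $\lambda\in[0,1]$. *$q$-weight maps.* Let $\hat\Lambda:\mathfrak B(\mathfrak H)_*\to\mathfrak B(\mathfrak K)_*$, $\hat\Lambda(\eta)(A)=\eta(\Lambda(A))$. For a linear map $\omega:\mathfrak B(\mathfrak K)_*\to\mathfrak A(\mathfrak H)_*$ put $\omega|_t(\rho)=(\omega(\rho))|_t$. Such an $\omega$ is a *$q$-weight map over $\mathfrak K$* if it is completely positive, $\omega(\rho)(I-\Lambda)\le\rho(I)$ for all positive $\rho$, and for every $t>0$ the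 map $I+\hat\Lambda\omega|_t$ on $\mathfrak B(\mathfrak K)_*$ is invertible and $\hat\pi_t=\omega|_t(I+\hat\Lambda\omega|_t)^{-1}:\mathfrak B(\mathfrak K)_*\to\mathfrak B(\mathfrak H)_*$ is a completely positive contraction; the dual maps $\pi_t^\#:\mathfrak B(\mathfrak H)\to\mathfrak B(\mathfrak K)$ form its generalized boundary representation. The *range rank* of $\omega$ is the dimension of the range of the map $\breve\omega:\mathfrak A(\mathfrak H)\to\mathfrak B(\mathfrak K)$ determined by $\rho(\breve\omega(B))=\omega(\rho)(B)$. If $\omega,\eta$ are $q$-weight maps with generalized boundary representations $\pi_t^\#,\xi_t^\#$, then $\eta$ is a *$q$-subordinate* of $\omega$ ($\eta\le_q\omega$) if $\pi^\#_t-\xi^\#_t$ is completely positive for every $t>0$. A $q$-weight map $\omega$ is *$q$-pure* if its set of $q$-subordinates is totally ordered by $\le_q$. **Theorem.** Let $\omega$ be a $q$-weight map over $\mathfrak K$ of range rank one, expressed as $$\omega(\rho)(A)=\rho(T)\,\mu(A)\qquad(\rho\in\mathfrak B(\mathfrak K)_*,\ A\in\mathfrak A(\mathfrak H)),$$ where $T\in\mathfrak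 B(\mathfrak K)$ is a positive operator of norm one and $\mu\in\mathfrak A(\mathfrak H)_*$ is a positive boundary weight with $\mu(I-\Lambda(T))\le1$. Then $\omega$ is $q$-pure if and only if the following three conditions hold: (i) $T$ is a projection; (ii) $\mu$ is a $q$-pure boundary weight; (iii) if $\operatorname{rank}(T)>1$, then $\mu(\Lambda(e))=\infty$ for every rank one projection $e\in\mathfrak B(\mathfrak K)$ with $e\le T$. -/

import Mathlib

open MeasureTheory Filter Topology
open scoped InnerProductSpace ComplexOrder ENNReal

noncomputable section

namespace QWeight

/-! ### Normal functionals and complete positivity -/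

section Normal

variable {H : Type*} [NormedAddCommGroup H] [InnerProductSpace ℂ H]

/-- A bounded functional on `B(H)` is normal (`σ`-weakly continuous) if it has the form
`A ↦ ∑ᵢ ⟪fᵢ, A gᵢ⟫` with `∑ᵢ ‖fᵢ‖² < ∞` and `∑ᵢ ‖gᵢ‖² < ∞`. -/
def IsNormal (φ : StrongDual ℂ (H →L[ℂ] H)) : Prop :=
  ∃ (ι : Type) (f g : ι → H), Summable (fun i => ‖f i‖ ^ 2) ∧ Summable (fun i => ‖g i‖ ^ 2) ∧
    ∀ A : H →L[ℂ] H, HasSum (fun i => ⟪f i, A (g i)⟫_ℂ) (φ A)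

variable (H) in
/-- The normal functionals form a subspace of the dual of `B(H)`. -/
def normalFunctionals : Submodule ℂ (StrongDual ℂ (H →L[ℂ] H)) where
  carrier := {φ | IsNormal φ}
  zero_mem' := ⟨Empty, Empty.elim, Empty.elim, summable_empty, summable_empty, fun A => by simp⟩
  add_mem' := by
    rintro φ ψ ⟨ι, f, g, hf, hg, h⟩ ⟨κ, f', g', hf', hg', h'⟩
    refine ⟨ι ⊕ κ, Sum.elim f f', Sum.elim g g', ?_, ?_, fun A => ?_⟩
    · exact (HasSum.sum (f := fun i => ‖Sum.elim f f' i‖ ^ 2) hf.hasSum hf'.hasSum).summable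
    · exact (HasSum.sum (f := fun i => ‖Sum.elim g g' i‖ ^ 2) hg.hasSum hg'.hasSum).summable
    · exact HasSum.sum (by simpa [Function.comp_def] using h A)
        (by simpa [Function.comp_def] using h' A)
  smul_mem' := by
    rintro c φ ⟨ι, f, g, hf, hg, h⟩
    refine ⟨ι, f, fun i => c • g i, hf, ?_, fun A => ?_⟩
    · simpa [norm_smul, mul_pow] using hg.mul_left (‖c‖ ^ 2)
    · simpa [inner_smul_right] using (h A).mul_left c

variable (H) in
/-- The predual `B(H)_*`: the space of normal functionals on `B(H)`, with the norm it
inherits from the dual of `B(H)`. -/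
def Predual : Type _ := normalFunctionals H

instance : NormedAddCommGroup (Predual H) :=
  inferInstanceAs (NormedAddCommGroup (normalFunctionals H))

set_option maxSynthPendingDepth 3 in
instance : NormedSpace ℂ (Predual H) :=
  inferInstanceAs (NormedSpace ℂ (normalFunctionals H))

/-- A normal functional is positive if it is nonnegative on positive operators. -/
def Predual.IsPositive (ρ : Predual H) : Prop :=
  ∀ A : H →L[ℂ] H, 0 ≤ A → 0 ≤ ρ.1 A

/-- A square matrix of operators on `H` is positive as an operator on `H ⊕ ⋯ ⊕ H`. -/
def IsPositiveMatrix {n : ℕ} (T : Fin n → Fin n → (H →L[ℂ] H)) : Prop :=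
  ∀ v : Fin n → H, 0 ≤ ∑ i, ∑ j, ⟪v i, T i j (v j)⟫_ℂ

/-- A square matrix `(ρᵢⱼ)` of normal functionals is positive if the functional
`(Tᵢⱼ) ↦ ∑ᵢⱼ ρᵢⱼ(Tᵢⱼ)` on `M_n(B(H))` is positive. -/
def Predual.IsPositiveMatrix {n : ℕ} (ρ : Fin n → Fin n → Predual H) : Prop :=
  ∀ T : Fin n → Fin n → (H →L[ℂ] H), QWeight.IsPositiveMatrix T →
    0 ≤ ∑ i, ∑ j, (ρ i j).1 (T i j)

/-- A linear map between preduals is completely positive if all its matrix amplifications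
preserve positivity; this says that its dual map is completely positive. -/
def IsCompletelyPositive {K : Type*} [NormedAddCommGroup K] [InnerProductSpace ℂ K]
    (Φ : Predual K →ₗ[ℂ] Predual H) : Prop :=
  ∀ (n : ℕ) (ρ : Fin n → Fin n → Predual K), Predual.IsPositiveMatrix ρ →
    Predual.IsPositiveMatrix (fun i j => Φ (ρ i j))

variable [CompleteSpace H]

/-- Precomposition of normal functionals with `A ↦ N A N`. -/
theorem isNormal_sandwich {φ : StrongDual ℂ (H →L[ℂ] H)} (hφ : IsNormal φ) (N : H →L[ℂ] H) :
    IsNormal (φ.comp (ContinuousLinearMap.mulLeftRight ℂ (H →L[ℂ] H) N N)) := by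
  obtain ⟨ι, f, g, hf, hg, h⟩ := hφ
  refine ⟨ι, fun i => N.adjoint (f i), fun i => N (g i), ?_, ?_, fun A => ?_⟩
  · refine Summable.of_nonneg_of_le (fun i => by positivity) (fun i => ?_)
      (hf.mul_left (‖N.adjoint‖ ^ 2))
    rw [← mul_pow]
    exact pow_le_pow_left₀ (norm_nonneg _) (N.adjoint.le_opNorm _) 2
  · refine Summable.of_nonneg_of_le (fun i => by positivity) (fun i => ?_)
      (hg.mul_left (‖N‖ ^ 2))
    rw [← mul_pow]
    exact pow_le_pow_left₀ (norm_nonneg _) (N.le_opNorm _) 2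
  · simpa [ContinuousLinearMap.adjoint_inner_left] using h (N * A * N)

end Normal

/-! ### The space `L²((0, ∞); K)` and its multiplication operators -/

/-- Lebesgue measure on `(0, ∞)`. -/
abbrev halfLine : Measure ℝ := volume.restrict (Set.Ioi 0)

/-- The Hilbert space `K ⊗ L²(0, ∞)`, realized as `L²((0, ∞); K)`. -/
abbrev HL (K : Type*) [NormedAddCommGroup K] := Lp K 2 halfLine

section Mul

variable {K : Type*} [NormedAddCommGroup K] [InnerProductSpace ℂ K]

/-- The operator `f ↦ g f` of multiplication by an essentially bounded function `g`. -/
def mulOp {g : ℝ → ℂ} (hg : MemLp g ∞ halfLine) : HL K →L[ℂ] HL K :=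
  LinearMap.mkContinuous
    { toFun := fun f => (hg.toLp g • f : HL K)
      map_add' := fun f f' => Lp.add_smul _ f f'
      map_smul' := fun c f => (Lp.smul_comm c (hg.toLp g) f).symm }
    ‖hg.toLp g‖ (fun f => Lp.norm_smul_le _ f)

theorem mulOp_coe {g : ℝ → ℂ} (hg : MemLp g ∞ halfLine) (f : HL K) :
    mulOp hg f =ᵐ[halfLine] fun x => g x • f x := by
  have h1 : mulOp hg f =ᵐ[halfLine] (⇑(hg.toLp g) • ⇑f) := Lp.coeFn_lpSMul (hg.toLp g) f
  filter_upwards [h1, hg.coeFn_toLp] with x hx hx'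
  rw [hx, Pi.smul_apply', hx']

theorem mulOp_mul {g h k : ℝ → ℂ} (hg : MemLp g ∞ halfLine) (hh : MemLp h ∞ halfLine)
    (hk : MemLp k ∞ halfLine) (e : ∀ x > 0, g x * h x = k x) :
    (mulOp hg * mulOp hh : HL K →L[ℂ] HL K) = mulOp hk := by
  ext1 f
  apply Lp.ext
  have hpos : ∀ᵐ x ∂halfLine, x ∈ Set.Ioi (0 : ℝ) := ae_restrict_mem measurableSet_Ioi
  filter_upwards [mulOp_coe hg (mulOp hh f), mulOp_coe hh f, mulOp_coe hk f, hpos]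
    with x h1 h2 h3 h4
  rw [mul_apply_eq_comp, h1, h2, h3, smul_smul, e x h4]

theorem memLp_of_bound {g : ℝ → ℝ} (hg : Measurable g) (C : ℝ) (h : ∀ x > 0, |g x| ≤ C) :
    MemLp (fun x => (g x : ℂ)) ∞ halfLine := by
  refine memLp_top_of_bound (by fun_prop) C ?_
  filter_upwards [ae_restrict_mem (measurableSet_Ioi (a := (0 : ℝ)))] with x hx
  simpa using h x hx

theorem memLp_exp : MemLp (fun x => ((Real.exp (-x) : ℝ) : ℂ)) ∞ halfLine :=
  memLp_of_bound (by fun_prop) 1 fun x hx => by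
    rw [abs_of_pos (Real.exp_pos _)]; exact Real.exp_le_one_iff.2 (by linarith)

theorem memLp_root : MemLp (fun x => ((√(1 - Real.exp (-x)) : ℝ) : ℂ)) ∞ halfLine :=
  memLp_of_bound (by fun_prop) 1 fun x hx => by
    rw [abs_of_nonneg (Real.sqrt_nonneg _)]
    exact Real.sqrt_le_one.2 (by linarith [Real.exp_pos (-x)])

theorem memLp_ind (t : ℝ) :
    MemLp (fun x => (((Set.Ioi t).indicator (fun _ => (1 : ℝ)) x : ℝ) : ℂ)) ∞ halfLine :=
  memLp_of_bound (measurable_const.indicator measurableSet_Ioi) 1 fun x _ => by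
    by_cases h : x ∈ Set.Ioi t <;> simp [h]

theorem memLp_indRoot (t : Set.Ioi (0 : ℝ)) : MemLp (fun x =>
    (((Set.Ioi t.1).indicator (fun x => (√(1 - Real.exp (-x)))⁻¹) x : ℝ) : ℂ)) ∞ halfLine := by
  have ht : 0 < t.1 := t.2
  refine memLp_of_bound (Measurable.indicator (by fun_prop) measurableSet_Ioi)
    (√(1 - Real.exp (-t.1)))⁻¹ fun x _ => ?_
  by_cases h : x ∈ Set.Ioi t.1
  · have hx : t.1 < x := h
    have h1 : Real.exp (-t.1) < 1 := Real.exp_lt_one_iff.2 (by linarith)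
    rw [Set.indicator_of_mem h, abs_of_nonneg (by positivity)]
    have h2 : Real.exp (-x) ≤ Real.exp (-t.1) := Real.exp_le_exp.2 (by linarith)
    have h3 : 0 < √(1 - Real.exp (-t.1)) := Real.sqrt_pos.2 (by linarith)
    gcongr
  · rw [Set.indicator_of_notMem h]; simp only [abs_zero]; positivity

variable (K) in
/-- Multiplication by `√(1 - e⁻ˣ)`, that is `(I - Λ(I))^{1/2}`. -/
def rootOp : HL K →L[ℂ] HL K := mulOp memLp_root

variable (K) in
/-- `E(t, ∞)`: multiplication by the indicator function of `(t, ∞)`, the projection onto the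
functions supported in `(t, ∞)`. -/
def cutOp (t : ℝ) : HL K →L[ℂ] HL K := mulOp (memLp_ind t)

variable (K) in
/-- Multiplication by `(1 - e⁻ˣ)^{-1/2}` on `(t, ∞)` and by `0` elsewhere. -/
def cutInvRoot (t : Set.Ioi (0 : ℝ)) : HL K →L[ℂ] HL K := mulOp (memLp_indRoot t)

theorem one_sub_exp_pos {x : ℝ} (hx : 0 < x) : 0 < 1 - Real.exp (-x) := by
  linarith [Real.exp_lt_one_iff.2 (by linarith : -x < 0)]

theorem rootOp_mul_cutInvRoot (t : Set.Ioi (0 : ℝ)) :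
    rootOp K * cutInvRoot K t = cutOp K t := by
  refine mulOp_mul _ _ _ fun x hx => ?_
  rw [← Complex.ofReal_mul]
  congr 1
  by_cases h : x ∈ Set.Ioi t.1
  · rw [Set.indicator_of_mem h, Set.indicator_of_mem h]
    exact mul_inv_cancel₀ (Real.sqrt_pos.2 (one_sub_exp_pos hx)).ne'
  · rw [Set.indicator_of_notMem h, Set.indicator_of_notMem h, mul_zero]

theorem cutInvRoot_mul_rootOp (t : Set.Ioi (0 : ℝ)) :
    cutInvRoot K t * rootOp K = cutOp K t := by
  refine mulOp_mul _ _ _ fun x hx => ?_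
  rw [← Complex.ofReal_mul]
  congr 1
  by_cases h : x ∈ Set.Ioi t.1
  · rw [Set.indicator_of_mem h, Set.indicator_of_mem h]
    exact inv_mul_cancel₀ (Real.sqrt_pos.2 (one_sub_exp_pos hx)).ne'
  · rw [Set.indicator_of_notMem h, Set.indicator_of_notMem h, zero_mul]

/-- The map `Λ : B(K) → B(H)`, `(Λ(A) f)(x) = e⁻ˣ A f(x)`. -/
def lam : (K →L[ℂ] K) →L[ℂ] (HL K →L[ℂ] HL K) :=
  LinearMap.mkContinuous (E := K →L[ℂ] K) (F := HL K →L[ℂ] HL K) (σ := RingHom.id ℂ)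
    { toFun := fun A => (mulOp memLp_exp : HL K →L[ℂ] HL K) * A.compLpL 2 halfLine
      map_add' := fun A B => by
        ext1 f
        change mulOp memLp_exp ((A + B).compLp f) =
          mulOp memLp_exp (A.compLp f) + mulOp memLp_exp (B.compLp f)
        rw [ContinuousLinearMap.add_compLp, map_add]
      map_smul' := fun c A => by
        ext1 f
        change mulOp memLp_exp ((c • A).compLp f) = c • mulOp memLp_exp (A.compLp f)
        rw [ContinuousLinearMap.smul_compLp, map_smul] }
    ‖(mulOp memLp_exp : HL K →L[ℂ] HL K)‖ (fun A => by
      refine (ContinuousLinearMap.opNorm_comp_le _ _).trans ?_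
      gcongr
      exact ContinuousLinearMap.norm_compLpL_le A)

theorem lam_apply (A : K →L[ℂ] K) (f : HL K) :
    lam A f =ᵐ[halfLine] fun x => ((Real.exp (-x) : ℝ) : ℂ) • A (f x) := by
  filter_upwards [mulOp_coe memLp_exp (A.compLp f), A.coeFn_compLp f] with x h1 h2
  rw [← h2, ← h1]
  rfl

theorem rootOp_mul_rootOp : rootOp K * rootOp K = 1 - lam (1 : K →L[ℂ] K) := by
  ext1 f
  apply Lp.ext
  have hpos : ∀ᵐ x ∂halfLine, x ∈ Set.Ioi (0 : ℝ) := ae_restrict_mem measurableSet_Ioi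
  filter_upwards [mulOp_coe memLp_root (rootOp K f), mulOp_coe memLp_root f,
    lam_apply (1 : K →L[ℂ] K) f, Lp.coeFn_sub f (lam (1 : K →L[ℂ] K) f), hpos]
    with x h1 h2 h3 h4 h5
  change (rootOp K (rootOp K f)) x = (f - lam (1 : K →L[ℂ] K) f : HL K) x
  rw [h4, Pi.sub_apply, h3]
  change (mulOp memLp_root (rootOp K f)) x = _
  rw [h1]
  change _ • (mulOp memLp_root f) x = _
  rw [h2, smul_smul, ← Complex.ofReal_mul, Real.mul_self_sqrt (one_sub_exp_pos h5).le,
    Complex.ofReal_sub, sub_smul]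
  simp

/-- The elementary tensor `u ⊗ φ`, that is `x ↦ φ(x) u`. -/
def elemTensor (φ : HL ℂ) (u : K) : HL K := (ContinuousLinearMap.toSpanSingleton ℂ u).compLp φ

theorem elemTensor_coe (φ : HL ℂ) (u : K) : elemTensor φ u =ᵐ[halfLine] fun x => φ x • u := by
  filter_upwards [(ContinuousLinearMap.toSpanSingleton ℂ u).coeFn_compLp φ] with x hx
  simpa [elemTensor, ContinuousLinearMap.toSpanSingleton_apply] using hx

theorem inner_elemTensor (φ ψ : HL ℂ) (u v : K) :
    ⟪elemTensor φ u, elemTensor ψ v⟫_ℂ = ⟪φ, ψ⟫_ℂ * ⟪u, v⟫_ℂ := by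
  rw [L2.inner_def, L2.inner_def, ← integral_mul_const]
  refine integral_congr_ae ?_
  filter_upwards [elemTensor_coe φ u, elemTensor_coe ψ v] with x h1 h2
  rw [h1, h2, inner_smul_left, inner_smul_right]
  simp only [RCLike.inner_apply]
  ring

/-- The isometry `u ↦ u ⊗ φ` for a unit vector `φ`. -/
def tensorIsometry (φ : HL ℂ) (hφ : ‖φ‖ = 1) : K →ₗᵢ[ℂ] HL K where
  toFun u := elemTensor φ u
  map_add' u v := by
    apply Lp.ext
    filter_upwards [elemTensor_coe φ u, elemTensor_coe φ v, elemTensor_coe φ (u + v),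
      Lp.coeFn_add (elemTensor φ u) (elemTensor φ v)] with x h1 h2 h3 h4
    rw [h3, h4, Pi.add_apply, h1, h2, smul_add]
  map_smul' c u := by
    apply Lp.ext
    filter_upwards [elemTensor_coe φ u, elemTensor_coe φ (c • u),
      Lp.coeFn_smul c (elemTensor φ u)] with x h1 h2 h3
    rw [h2, RingHom.id_apply, h3, Pi.smul_apply, h1, smul_comm]
  norm_map' u := by
    have h := inner_elemTensor φ φ u u
    rw [inner_self_eq_norm_sq_to_K, inner_self_eq_norm_sq_to_K, inner_self_eq_norm_sq_to_K, hφ] at h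
    have h' : ‖elemTensor φ u‖ ^ 2 = ‖u‖ ^ 2 := by
      have : ((‖elemTensor φ u‖ ^ 2 : ℝ) : ℂ) = ((‖u‖ ^ 2 : ℝ) : ℂ) := by
        push_cast
        simpa using h
      exact_mod_cast this
    exact (pow_left_inj₀ (norm_nonneg _) (norm_nonneg _) two_ne_zero).1 h'

theorem isHilbertSum_tensor [CompleteSpace K] {J : Type*} (b : HilbertBasis J ℂ (HL ℂ)) :
    IsHilbertSum ℂ (fun _ : J => K) (fun j => tensorIsometry (b j) (b.orthonormal.1 j)) := by
  refine IsHilbertSum.mk ?_ ?_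
  · intro i j hij u v
    change ⟪elemTensor (b i) u, elemTensor (b j) v⟫_ℂ = 0
    rw [inner_elemTensor, b.orthonormal.2 hij, zero_mul]
  · intro f _
    set S := (⨆ j, LinearMap.range
      (tensorIsometry (K := K) (b j) (b.orthonormal.1 j)).toLinearMap).topologicalClosure with hS
    have key : ∀ (u : K) (φ : HL ℂ), elemTensor φ u ∈ S := by
      intro u φ
      let L : HL ℂ →L[ℂ] HL K := (ContinuousLinearMap.toSpanSingleton ℂ u).compLpL 2 halfLine
      have h1 : Submodule.span ℂ (Set.range b) ≤ S.comap (L : HL ℂ →ₗ[ℂ] HL K) := by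
        rw [Submodule.span_le]
        rintro _ ⟨j, rfl⟩
        exact Submodule.le_topologicalClosure _ (Submodule.mem_iSup_of_mem j ⟨u, rfl⟩)
      have h2 : IsClosed ((S.comap (L : HL ℂ →ₗ[ℂ] HL K) : Submodule ℂ (HL ℂ)) : Set (HL ℂ)) :=
        (Submodule.isClosed_topologicalClosure _).preimage L.continuous
      have h3 := Submodule.topologicalClosure_minimal _ h1 h2
      rw [b.dense_span] at h3
      exact h3 (Submodule.mem_top (x := φ))
    refine Lp.induction (by simp) (fun f => f ∈ S) ?_ ?_ ?_ f
    · intro c s hs hμs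
      rw [Lp.simpleFunc.coe_indicatorConst]
      convert key c (indicatorConstLp 2 hs hμs.ne (1 : ℂ)) using 1
      apply Lp.ext
      filter_upwards [elemTensor_coe (indicatorConstLp 2 hs hμs.ne (1 : ℂ)) c,
        indicatorConstLp_coeFn (p := 2) (hs := hs) (hμs := hμs.ne) (c := c),
        indicatorConstLp_coeFn (p := 2) (hs := hs) (hμs := hμs.ne) (c := (1 : ℂ))] with x h1 h2 h3
      rw [h1, h2, h3]
      by_cases hx : x ∈ s <;> simp [hx]
    · intro f g hf hg _ h1 h2
      exact S.add_mem h1 h2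
    · exact Submodule.isClosed_topologicalClosure _

/-- Expansion of the elements of `L²((0, ∞); K)` along an orthonormal basis of `L²(0, ∞)`. -/
theorem exists_coefficients [CompleteSpace K] : ∃ (J : Type) (e : HL K → J → K),
    (∀ w, HasSum (fun j => ‖e w j‖ ^ 2) (‖w‖ ^ 2)) ∧
    (∀ w w', HasSum (fun j => ⟪e w j, e w' j⟫_ℂ) ⟪w, w'⟫_ℂ) ∧
    ∀ (A : K →L[ℂ] K) (w : HL K) (j : J), e (A.compLp w) j = A (e w j) := by
  obtain ⟨J, b, -⟩ := exists_hilbertBasis ℂ (HL ℂ)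
  have hV := isHilbertSum_tensor (K := K) b
  have hsq : ∀ w : HL K, HasSum (fun j => ‖hV.linearIsometryEquiv w j‖ ^ 2) (‖w‖ ^ 2) := by
    intro w
    have := lp.hasSum_norm (p := 2) (by norm_num) (hV.linearIsometryEquiv w)
    simpa using this
  refine ⟨J, fun w j => hV.linearIsometryEquiv w j, hsq, fun w w' => ?_, fun A w j => ?_⟩
  · have h1 := lp.hasSum_inner (𝕜 := ℂ) (hV.linearIsometryEquiv w) (hV.linearIsometryEquiv w')
    rw [LinearIsometryEquiv.inner_map_map] at h1
    exact h1
  · have h1 := hV.hasSum_linearIsometryEquiv_symm (hV.linearIsometryEquiv w)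
    rw [LinearIsometryEquiv.symm_apply_apply] at h1
    have h2 := h1.mapL (A.compLpL 2 halfLine)
    have h3 : ∀ (i : J) (u : K), A.compLpL 2 halfLine (tensorIsometry (b i) (b.orthonormal.1 i) u)
        = tensorIsometry (b i) (b.orthonormal.1 i) (A u) := by
      intro i u
      change A.compLp (elemTensor (b i) u) = elemTensor (b i) (A u)
      apply Lp.ext
      filter_upwards [A.coeFn_compLp (elemTensor (b i) u), elemTensor_coe (b i) u,
        elemTensor_coe (b i) (A u)] with x h1 h2 h3
      rw [h1, h2, h3, map_smul]
    simp only [h3] at h2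
    have hmem : Memℓp (fun i => A (hV.linearIsometryEquiv w i)) 2 := by
      refine memℓp_gen ?_
      refine Summable.of_nonneg_of_le (fun i => by positivity) (fun i => ?_)
        ((hsq w).summable.mul_left (‖A‖ ^ 2))
      rw [← mul_pow]
      simpa using pow_le_pow_left₀ (norm_nonneg _) (A.le_opNorm (hV.linearIsometryEquiv w i)) 2
    have h4 := hV.hasSum_linearIsometryEquiv_symm ⟨fun i => A (hV.linearIsometryEquiv w i), hmem⟩
    have h5 := h2.unique h4
    have h6 := congrArg hV.linearIsometryEquiv h5
    rw [LinearIsometryEquiv.apply_symm_apply] at h6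
    exact congrArg (fun z : lp (fun _ : J => K) 2 => z j) h6

theorem summable_coefficients {H J ι K : Type*} [NormedAddCommGroup H] [NormedAddCommGroup K] {e : H → J → K}
    (hsq : ∀ w, HasSum (fun j => ‖e w j‖ ^ 2) (‖w‖ ^ 2)) {w : ι → H}
    (hw : Summable (fun i => ‖w i‖ ^ 2)) :
    Summable (fun p : ι × J => ‖e (w p.1) p.2‖ ^ 2) := by
  rw [summable_prod_of_nonneg (fun _ => by positivity)]
  refine ⟨fun i => (hsq (w i)).summable, ?_⟩
  simpa only [(hsq _).tsum_eq] using hw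

theorem hasSum_of_fiberwise {J ι : Type*} {f g : ι × J → K}
    (hf : Summable (fun p => ‖f p‖ ^ 2)) (hg : Summable (fun p => ‖g p‖ ^ 2)) (A : K →L[ℂ] K)
    {B : ι → ℂ} {c : ℂ} (hB : HasSum B c)
    (hfib : ∀ i, HasSum (fun j => ⟪f (i, j), A (g (i, j))⟫_ℂ) (B i)) :
    HasSum (fun p => ⟪f p, A (g p)⟫_ℂ) c := by
  have hsum : Summable (fun p => ⟪f p, A (g p)⟫_ℂ) := by
    refine Summable.of_norm_bounded ((hf.add hg).mul_left ‖A‖) fun p => ?_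
    refine (norm_inner_le_norm _ _).trans ?_
    calc ‖f p‖ * ‖A (g p)‖ ≤ ‖f p‖ * (‖A‖ * ‖g p‖) := by gcongr; exact A.le_opNorm _
      _ = ‖A‖ * (‖f p‖ * ‖g p‖) := by ring
      _ ≤ _ := by
        gcongr
        nlinarith [sq_nonneg (‖f p‖ - ‖g p‖), norm_nonneg (f p), norm_nonneg (g p)]
  have h1 := hsum.hasSum.prod_fiberwise hfib
  rw [← h1.unique hB]
  exact hsum.hasSum

/-- `Λ` is normal: precomposition with `Λ` preserves normal functionals. -/
theorem isNormal_lam [CompleteSpace K] {φ : StrongDual ℂ (HL K →L[ℂ] HL K)} (hφ : IsNormal φ) :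
    IsNormal (φ.comp (lam : (K →L[ℂ] K) →L[ℂ] (HL K →L[ℂ] HL K))) := by
  obtain ⟨ι, f, g, hf, hg, h⟩ := hφ
  obtain ⟨J, e, hsq, hinner, hcoef⟩ := exists_coefficients (K := K)
  obtain ⟨M, hM⟩ : ∃ M : HL K →L[ℂ] HL K, ∀ (A : K →L[ℂ] K) w, lam A w = M (A.compLp w) :=
    ⟨mulOp memLp_exp, fun _ _ => rfl⟩
  have hMf : Summable (fun i => ‖M.adjoint (f i)‖ ^ 2) := by
    refine Summable.of_nonneg_of_le (fun i => by positivity) (fun i => ?_)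
      (hf.mul_left (‖M.adjoint‖ ^ 2))
    rw [← mul_pow]
    exact pow_le_pow_left₀ (norm_nonneg _) (M.adjoint.le_opNorm _) 2
  have hfib : ∀ (A : K →L[ℂ] K) i, HasSum (fun j => ⟪e (M.adjoint (f i)) j, A (e (g i) j)⟫_ℂ)
      ⟪f i, lam A (g i)⟫_ℂ := by
    intro A i
    have h1 := hinner (M.adjoint (f i)) (A.compLp (g i))
    rw [ContinuousLinearMap.adjoint_inner_left, ← hM] at h1
    simp only [hcoef] at h1
    exact h1
  have h1 := summable_coefficients hsq hMf
  have h2 := summable_coefficients hsq hg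
  refine ⟨ι × J, fun p => e (M.adjoint (f p.1)) p.2, fun p => e (g p.1) p.2, h1, h2, fun A => ?_⟩
  exact hasSum_of_fiberwise h1 h2 A (h (lam A)) (hfib A)

end Mul

/-! ### Boundary weights -/

section Weights

variable (K : Type*) [NormedAddCommGroup K] [InnerProductSpace ℂ K]

/-- `A(H) = (I - Λ(I))^{1/2} B(H) (I - Λ(I))^{1/2}` for `H = K ⊗ L²(0, ∞)`. -/
def boundaryAlgebra : Submodule ℂ (HL K →L[ℂ] HL K) :=
  LinearMap.range
    (ContinuousLinearMap.mulLeftRight ℂ (HL K →L[ℂ] HL K) (rootOp K) (rootOp K)).toLinearMap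

variable {K}

theorem root_mul_mul_root_mem (A : HL K →L[ℂ] HL K) :
    rootOp K * A * rootOp K ∈ boundaryAlgebra K :=
  ⟨A, rfl⟩

theorem cut_mul_mul_cut_eq (t : Set.Ioi (0 : ℝ)) (A : HL K →L[ℂ] HL K) :
    cutOp K t * A * cutOp K t =
      rootOp K * (cutInvRoot K t * A * cutInvRoot K t) * rootOp K := by
  calc cutOp K t * A * cutOp K t
      = (rootOp K * cutInvRoot K t) * A * (cutInvRoot K t * rootOp K) := by
        rw [rootOp_mul_cutInvRoot, cutInvRoot_mul_rootOp]
    _ = _ := by simp only [mul_assoc]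

theorem cut_mul_mul_cut_mem (t : Set.Ioi (0 : ℝ)) (A : HL K →L[ℂ] HL K) :
    cutOp K t * A * cutOp K t ∈ boundaryAlgebra K := by
  rw [cut_mul_mul_cut_eq]
  exact root_mul_mul_root_mem _

theorem one_sub_lam_mem : 1 - lam (1 : K →L[ℂ] K) ∈ boundaryAlgebra K := by
  rw [← rootOp_mul_rootOp]
  simpa using root_mul_mul_root_mem (1 : HL K →L[ℂ] HL K)

variable (K) in
/-- The space `A(H)_*` of boundary weights: the linear functionals `μ` on `A(H)` for which
`A ↦ μ((I - Λ(I))^{1/2} A (I - Λ(I))^{1/2})` is a normal bounded functional on `B(H)`. -/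
def boundaryWeights : Submodule ℂ (Module.Dual ℂ (boundaryAlgebra K)) where
  carrier := {μ | ∃ ℓ : Predual (HL K), ∀ A : HL K →L[ℂ] HL K,
    ℓ.1 A = μ ⟨rootOp K * A * rootOp K, root_mul_mul_root_mem A⟩}
  zero_mem' := ⟨0, fun _ => rfl⟩
  add_mem' := by
    rintro μ ν ⟨ℓ, h⟩ ⟨m, h'⟩
    exact ⟨ℓ + m, fun A => by
      rw [LinearMap.add_apply, ← h, ← h']; rfl⟩
  smul_mem' := by
    rintro c μ ⟨ℓ, h⟩
    exact ⟨c • ℓ, fun A => by rw [LinearMap.smul_apply, ← h]; rfl⟩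

/-- A boundary weight is positive if it is nonnegative on the positive elements of `A(H)`. -/
def IsPositiveWeight (μ : boundaryWeights K) : Prop :=
  ∀ A : boundaryAlgebra K, 0 ≤ A.1 → 0 ≤ μ.1 A

/-- The truncation `A ↦ E(t, ∞) A E(t, ∞)` as a linear map from `B(H)` to `A(H)`. -/
def cutMap (t : Set.Ioi (0 : ℝ)) : (HL K →L[ℂ] HL K) →ₗ[ℂ] boundaryAlgebra K where
  toFun A := ⟨cutOp K t * A * cutOp K t, cut_mul_mul_cut_mem t A⟩
  map_add' A B := by
    ext1
    simp [mul_add, add_mul]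
  map_smul' c A := by
    ext1
    simp

theorem exists_normal_truncation [CompleteSpace K] (t : Set.Ioi (0 : ℝ)) (μ : boundaryWeights K) :
    ∃ φ : StrongDual ℂ (HL K →L[ℂ] HL K), IsNormal φ ∧ ∀ A, φ A = μ.1 (cutMap t A) := by
  obtain ⟨ℓ, h⟩ := μ.2
  refine ⟨_, isNormal_sandwich ℓ.2 (cutInvRoot K t), fun A => ?_⟩
  refine (h (cutInvRoot K t * A * cutInvRoot K t)).trans (congrArg μ.1 (Subtype.ext ?_))
  exact (cut_mul_mul_cut_eq t A).symm

variable [CompleteSpace K]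

/-- The truncation `μ|ₜ`, the normal functional `μ|ₜ(A) = μ(E(t, ∞) A E(t, ∞))` on `B(H)`, as a
linear map in the boundary weight `μ`. -/
def truncate (t : Set.Ioi (0 : ℝ)) : boundaryWeights K →ₗ[ℂ] Predual (HL K) where
  toFun μ := ⟨⟨μ.1 ∘ₗ cutMap t, by
      obtain ⟨φ, -, h⟩ := exists_normal_truncation t μ
      exact φ.continuous.congr h⟩, by
      obtain ⟨φ, hφ, h⟩ := exists_normal_truncation t μ
      have e : φ = ⟨μ.1 ∘ₗ cutMap t, φ.continuous.congr h⟩ := ContinuousLinearMap.ext h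
      exact e ▸ hφ⟩
  map_add' _ _ := rfl
  map_smul' _ _ := rfl

/-- The value `μ(A) = lim_{t → 0+} μ|ₜ(A)` in `[-∞, ∞]` of a boundary weight at an operator
`A ∈ B(H)` (written as a lower limit; `μ(A) = ∞` means exactly that `μ|ₜ(A) → ∞`). -/
def weightValue (μ : boundaryWeights K) (A : HL K →L[ℂ] HL K) : EReal :=
  liminf (fun t : Set.Ioi (0 : ℝ) => (((truncate t μ).1 A).re : EReal)) (comap Subtype.val (𝓝 0))

/-- The order `ω ≥_q η` on positive boundary weights. -/
def WeightQDominates (ω η : boundaryWeights K) : Prop :=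
  ∀ (t : Set.Ioi (0 : ℝ)) (A : HL K →L[ℂ] HL K), 0 ≤ A →
    ((truncate t η).1 A).re / (1 + ((truncate t η).1 (lam 1)).re) ≤
      ((truncate t ω).1 A).re / (1 + ((truncate t ω).1 (lam 1)).re)

/-- `q`-purity of a positive boundary weight `ω`: the positive boundary weights `η` with
`ω ≥_q η ≥_q 0` are exactly the multiples `c ω` with `0 ≤ c ≤ 1`. -/
def IsQPureWeight (ω : boundaryWeights K) : Prop :=
  ∀ η : boundaryWeights K, IsPositiveWeight η →
    ((WeightQDominates ω η ∧ WeightQDominates η 0) ↔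
      ∃ c : ℝ, 0 ≤ c ∧ c ≤ 1 ∧ η = (c : ℂ) • ω)

/-! ### Boundary weight maps and `q`-weight maps -/

variable (K) in
/-- A boundary weight map over `K`: a linear map from `B(K)_*` to `A(H)_*`. -/
abbrev BoundaryWeightMap := Predual K →ₗ[ℂ] boundaryWeights K

/-- Complete positivity of a boundary weight map: all its matrix amplifications preserve
positivity. -/
def IsCompletelyPositiveWeightMap (ω : BoundaryWeightMap K) : Prop :=
  ∀ (n : ℕ) (ρ : Fin n → Fin n → Predual K), Predual.IsPositiveMatrix ρ →
    ∀ T : Fin n → Fin n → boundaryAlgebra K, IsPositiveMatrix (fun i j => (T i j).1) →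
      0 ≤ ∑ i, ∑ j, (ω (ρ i j)).1 (T i j)

variable (K) in
/-- The predual map `Λ̂ : B(H)_* → B(K)_*` of `Λ`, `Λ̂(η)(A) = η(Λ(A))`. -/
def lamHat : Predual (HL K) →ₗ[ℂ] Predual K where
  toFun η := ⟨η.1.comp lam, isNormal_lam η.2⟩
  map_add' _ _ := rfl
  map_smul' _ _ := rfl

/-- The truncated boundary weight map `ω|ₜ : B(K)_* → B(H)_*`. -/
def truncateMap (ω : BoundaryWeightMap K) (t : Set.Ioi (0 : ℝ)) :
    Predual K →ₗ[ℂ] Predual (HL K) :=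
  truncate t ∘ₗ ω

/-- The map `I + Λ̂ ω|ₜ` on `B(K)_*`. -/
def onePlus (ω : BoundaryWeightMap K) (t : Set.Ioi (0 : ℝ)) : Module.End ℂ (Predual K) :=
  1 + lamHat K ∘ₗ truncateMap ω t

/-- `π̂ₜ = ω|ₜ (I + Λ̂ ω|ₜ)⁻¹`, the predual form of the generalized boundary representation;
it is meaningful when `I + Λ̂ ω|ₜ` is invertible. -/
def boundaryRep (ω : BoundaryWeightMap K) (t : Set.Ioi (0 : ℝ)) :
    Predual K →ₗ[ℂ] Predual (HL K) :=
  truncateMap ω t ∘ₗ Ring.inverse (onePlus ω t)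

/-- A `q`-weight map over `K`. -/
structure IsQWeightMap (ω : BoundaryWeightMap K) : Prop where
  completelyPositive : IsCompletelyPositiveWeightMap ω
  /-- `ω(ρ)(I - Λ(I)) ≤ ρ(I)` for positive `ρ`. -/
  bound : ∀ ρ : Predual K, ρ.IsPositive →
    ((ω ρ).1 ⟨1 - lam 1, one_sub_lam_mem⟩).re ≤ (ρ.1 1).re
  invertible : ∀ t, IsUnit (onePlus ω t)
  boundaryRep_completelyPositive : ∀ t, IsCompletelyPositive (boundaryRep ω t)
  boundaryRep_contraction : ∀ t ρ, ‖boundaryRep ω t ρ‖ ≤ ‖ρ‖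

/-- The relation `η ≤_q ω` between `q`-weight maps: the difference of the generalized boundary
representations of `ω` and `η` is completely positive for every `t > 0`. -/
def QSubordinate (η ω : BoundaryWeightMap K) : Prop :=
  ∀ t, IsCompletelyPositive (boundaryRep ω t - boundaryRep η t)

/-- `q`-purity of a `q`-weight map `ω`: the set of `q`-weight maps that are `q`-subordinates of
`ω` is totally ordered by `q`-subordination. -/
def IsQPure (ω : BoundaryWeightMap K) : Prop :=
  ∀ η η' : BoundaryWeightMap K, IsQWeightMap η → IsQWeightMap η' →
    QSubordinate η ω → QSubordinate η' ω → QSubordinate η η' ∨ QSubordinate η' η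

/-- `ω` has range rank `n`: the range of the dualized map `ω˘ : A(H) → B(K)`, which is determined
by `ρ(ω˘(B)) = ω(ρ)(B)`, has dimension `n`. -/
def HasRangeRank (ω : BoundaryWeightMap K) (n : ℕ) : Prop :=
  ∃ W : boundaryAlgebra K →ₗ[ℂ] (K →L[ℂ] K),
    (∀ (ρ : Predual K) (B : boundaryAlgebra K), ρ.1 (W B) = (ω ρ).1 B) ∧ LinearMap.rank W = n

end Weights

end QWeight

end

open QWeight

noncomputable section

namespace QWeight

/-! ### Positive operators and positive functionals -/

section Positivity

variable {H : Type*} [NormedAddCommGroup H] [InnerProductSpace ℂ H]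

/-! Write `h(t) = μ|ₜ(Λ(T))`. For a map `ρ ↦ ρ(T) μ` the operator `I + Λ̂ω|ₜ` is a rank one
perturbation of the identity, so the boundary representation is explicit: `π̂ₜ(ρ) = ρ(T) / (1 +
h(t)) · μ|ₜ` (`boundaryRep_rankOneMap`). All comparisons of such maps become scalar or operator
inequalities.

The multiples `cω`, `0 ≤ c ≤ 1`, form a continuous chain of `q`-subordinates. If the subordinates
are totally ordered, each subordinate `η` is comparable with every `cω`; since `[0, 1]` is
connected, some `cω` lies both below and above `η`, hence equals it. So `q`-purity means that every
subordinate is a multiple of `ω` (`isQPure_iff_subordinates_eq_smul`).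

Necessity. If `0 ≤ X ≤ T` and `μ|ₜ(Λ(X)) ≤ 1` for all `t`, then `(T - X)/2` defines a subordinate,
so `X` is a multiple of `T` (`eq_smul_of_trunc_lam_le_one`). Taking `X = T - T²`, on which `μ` is
bounded because `T - T² ≤ I - T`, forces `T² = T`. Taking `X` a small multiple of a rank one
projection `e ≤ T` with `μ(Λ(e)) < ∞` forces `rank T ≤ 1`. A weight `η` with `μ ≥_q η` gives the
subordinate `ρ(T) η`, so `μ` is `q`-pure.

Sufficiency. Let `η` be a subordinate and `ρ ≥ 0`. Subordination bounds `η(ρ)|ₜ` by a `t`-dependent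
multiple of `μ|ₜ`; the factor is monotone in `t`, so its infimum works uniformly (`exists_factor`),
and a small multiple of `η(ρ)` is then dominated by `μ` in the `q`-order. Purity of `μ` yields `η(ρ)
= F(ρ) μ`, and `0 ≤ F(ρ) ≤ ρ(T)` makes `F` evaluation at an operator `0 ≤ D ≤ T`
(`exists_eq_evalAt`). Subordination gives `(1 + h) D ≤ (1 + μ|ₜ(Λ(D))) T` for small `t`; taking
norms, `μ|ₜ(Λ(‖D‖T - D)) ≤ 1 - ‖D‖`. A nonzero `‖D‖T - D ≥ 0` would dominate a positive multiple of
a rank one projection below `T`, so for `rank T > 1` condition (iii) leaves only `D = ‖D‖T`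
(`operator_eq_smul_of_subordinate`). -/

theorem nonneg_iff_inner (A : H →L[ℂ] H) : 0 ≤ A ↔ ∀ x, 0 ≤ ⟪x, A x⟫_ℂ := by
  rw [ContinuousLinearMap.nonneg_iff_isPositive]
  refine ⟨fun h => h.inner_nonneg_right, fun h => ?_⟩
  rw [ContinuousLinearMap.isPositive_iff_complex]
  intro x
  have h1 := h x
  rw [Complex.nonneg_iff] at h1
  have e : ⟪A x, x⟫_ℂ = ⟪x, A x⟫_ℂ := by
    rw [← inner_conj_symm]
    exact Complex.conj_eq_iff_im.2 h1.2.symm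
  rw [e]
  exact ⟨Complex.ext rfl h1.2, h1.1⟩

theorem isPositiveMatrix_const {A : H →L[ℂ] H} (hA : 0 ≤ A) :
    IsPositiveMatrix (fun _ _ : Fin 1 => A) := fun v => by
  simpa using (nonneg_iff_inner A).1 hA (v 0)

theorem Predual.ext {ρ σ : Predual H} (h : ∀ A, ρ.1 A = σ.1 A) : ρ = σ :=
  Subtype.ext (ContinuousLinearMap.ext h)

theorem Predual.isPositiveMatrix_const {ρ : Predual H} (hρ : ρ.IsPositive) :
    Predual.IsPositiveMatrix (fun _ _ : Fin 1 => ρ) := fun T hT => by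
  simp only [Fin.sum_univ_one]
  refine hρ _ ((nonneg_iff_inner _).2 fun x => ?_)
  simpa using hT (fun _ => x)

variable (H) in
/-- Evaluation of normal functionals at an operator. -/
def evalAt (D : H →L[ℂ] H) : Predual H →ₗ[ℂ] ℂ where
  toFun ρ := ρ.1 D
  map_add' _ _ := rfl
  map_smul' _ _ := rfl

@[simp] theorem evalAt_apply (D : H →L[ℂ] H) (ρ : Predual H) : evalAt H D ρ = ρ.1 D := rfl

@[simp] theorem Predual.add_apply (ρ σ : Predual H) (A : H →L[ℂ] H) :
    (ρ + σ).1 A = ρ.1 A + σ.1 A := rfl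

@[simp] theorem Predual.sub_apply (ρ σ : Predual H) (A : H →L[ℂ] H) :
    (ρ - σ).1 A = ρ.1 A - σ.1 A := rfl

@[simp] theorem Predual.zero_apply (A : H →L[ℂ] H) : (0 : Predual H).1 A = 0 := rfl

@[simp] theorem Predual.smul_apply (c : ℂ) (ρ : Predual H) (A : H →L[ℂ] H) :
    (c • ρ).1 A = c * ρ.1 A := rfl

theorem Predual.sum_apply {ι : Type*} (s : Finset ι) (ρ : ι → Predual H) (A : H →L[ℂ] H) :
    (∑ i ∈ s, ρ i).1 A = ∑ i ∈ s, (ρ i).1 A := map_sum (evalAt H A) ρ s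

theorem Predual.map_sub (ρ : Predual H) (A B : H →L[ℂ] H) : ρ.1 (A - B) = ρ.1 A - ρ.1 B :=
  _root_.map_sub ρ.1 A B

theorem Predual.map_zero (ρ : Predual H) : ρ.1 (0 : H →L[ℂ] H) = 0 := _root_.map_zero ρ.1

theorem Predual.map_smul (ρ : Predual H) (c : ℂ) (A : H →L[ℂ] H) : ρ.1 (c • A) = c * ρ.1 A :=
  _root_.map_smul ρ.1 c A

/-- A completely positive map between preduals is positive. -/
theorem IsCompletelyPositive.map_isPositive {K : Type*} [NormedAddCommGroup K]
    [InnerProductSpace ℂ K] {Φ : Predual K →ₗ[ℂ] Predual H} (hΦ : IsCompletelyPositive Φ)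
    {ρ : Predual K} (hρ : ρ.IsPositive) : (Φ ρ).IsPositive := fun A hA => by
  simpa using hΦ 1 _ (Predual.isPositiveMatrix_const hρ) _ (QWeight.isPositiveMatrix_const hA)

variable [CompleteSpace H]

theorem sandwich_nonneg {A B : H →L[ℂ] H} (hB : IsSelfAdjoint B) (hA : 0 ≤ A) :
    0 ≤ B * A * B :=
  hB.conjugate_nonneg hA

/-- Positive operators span `B(H)`, so no continuity of the two maps is needed. -/
theorem eq_of_eq_on_nonneg {V : Type*} [AddCommGroup V] [Module ℂ V]
    {φ ψ : (H →L[ℂ] H) →ₗ[ℂ] V} (h : ∀ A, 0 ≤ A → φ A = ψ A) : φ = ψ := by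
  refine LinearMap.ext_on (s := {A | 0 ≤ A}) CStarAlgebra.span_nonneg fun A hA => h A hA

/-- A positive functional attains its norm at the identity. -/
theorem norm_apply_le_of_positive (φ : (H →L[ℂ] H) →ₗ[ℂ] ℂ) (hφ : ∀ A, 0 ≤ A → 0 ≤ φ A)
    (A : H →L[ℂ] H) : ‖φ A‖ ≤ (φ 1).re * ‖A‖ := by
  set f : (H →L[ℂ] H) →ₚ[ℂ] ℂ := PositiveLinearMap.mk₀ φ hφ with hf
  have hfφ : ∀ B, f B = φ B := fun _ => rfl
  have h1 : 0 ≤ φ 1 := hφ 1 zero_le_one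
  have h1r := (Complex.nonneg_iff.1 h1).1
  -- Cauchy–Schwarz for the semi-inner product `φ(A* B)` at `1` and `A`, to be combined with `φ(A*
  -- A) ≤ φ(1) ‖A‖²`.
  have key := norm_inner_le_norm (𝕜 := ℂ) (f.toPreGNS 1) (f.toPreGNS A)
  have e1 : ‖f.toPreGNS 1‖ ^ 2 = (φ 1).re := by
    have := f.preGNS_norm_sq (f.toPreGNS 1)
    simp only [PositiveLinearMap.ofPreGNS_toPreGNS, star_one, mul_one, hfφ] at this
    rw [← this]; norm_cast
  have e2 : ‖f.toPreGNS A‖ ^ 2 = (φ (star A * A)).re := by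
    have := f.preGNS_norm_sq (f.toPreGNS A)
    simp only [PositiveLinearMap.ofPreGNS_toPreGNS, hfφ] at this
    rw [← this]; norm_cast
  have e3 : ⟪f.toPreGNS 1, f.toPreGNS A⟫_ℂ = φ A := by
    rw [PositiveLinearMap.preGNS_inner_def]; simp [hfφ]
  rw [e3] at key
  have e4 : (φ (star A * A)).re ≤ (φ 1).re * ‖A‖ ^ 2 := by
    have := f.norm_apply_le_of_nonneg _ (star_mul_self_nonneg A)
    have hn : ‖φ 1‖ = (φ 1).re := by
      rw [← Complex.ofReal_inj]; exact Complex.norm_of_nonneg' h1 |>.trans (Complex.ext rfl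
        (Complex.nonneg_iff.1 h1).2.symm)
    rw [hfφ, hfφ, CStarRing.norm_star_mul_self, hn] at this
    calc _ ≤ _ := Complex.re_le_norm _
      _ ≤ _ := this
      _ = _ := by ring
  have e5 : ‖f.toPreGNS A‖ ^ 2 ≤ (φ 1).re * ‖A‖ ^ 2 := e2 ▸ e4
  refine key.trans ?_
  refine abs_le_of_sq_le_sq' ?_ (by positivity) |>.2
  calc _ = ‖f.toPreGNS 1‖ ^ 2 * ‖f.toPreGNS A‖ ^ 2 := by ring
    _ ≤ (φ 1).re * ((φ 1).re * ‖A‖ ^ 2) := by rw [e1]; gcongr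
    _ = _ := by ring

end Positivity

/-! ### Normal functionals given by square summable families -/

section Families

variable {H : Type*} [NormedAddCommGroup H] [InnerProductSpace ℂ H] {ι : Type}

theorem norm_inner_apply_le (A : H →L[ℂ] H) (u v : H) :
    ‖⟪u, A v⟫_ℂ‖ ≤ ‖A‖ * (‖u‖ ^ 2 + ‖v‖ ^ 2) := by
  refine (norm_inner_le_norm _ _).trans ?_
  calc ‖u‖ * ‖A v‖ ≤ ‖u‖ * (‖A‖ * ‖v‖) := by gcongr; exact A.le_opNorm _
    _ = ‖A‖ * (‖u‖ * ‖v‖) := by ring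
    _ ≤ _ := by
      gcongr
      nlinarith [sq_nonneg (‖u‖ - ‖v‖), norm_nonneg u, norm_nonneg v]

theorem summable_inner_apply {f g : ι → H} (hf : Summable fun i => ‖f i‖ ^ 2)
    (hg : Summable fun i => ‖g i‖ ^ 2) (A : H →L[ℂ] H) :
    Summable fun i => ⟪f i, A (g i)⟫_ℂ :=
  Summable.of_norm_bounded ((hf.add hg).mul_left ‖A‖) fun _ => norm_inner_apply_le A _ _

/-- The normal functional `A ↦ ∑ᵢ ⟪fᵢ, A gᵢ⟫`. -/
def familyFunctional (f g : ι → H) (hf : Summable fun i => ‖f i‖ ^ 2)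
    (hg : Summable fun i => ‖g i‖ ^ 2) : Predual H :=
  ⟨LinearMap.mkContinuous
    { toFun := fun A => ∑' i, ⟪f i, A (g i)⟫_ℂ
      map_add' := fun A B => by
        rw [← (summable_inner_apply hf hg A).tsum_add (summable_inner_apply hf hg B)]
        simp
      map_smul' := fun c A => by
        rw [RingHom.id_apply, smul_eq_mul, ← tsum_mul_left]
        simp }
    (∑' i, (‖f i‖ ^ 2 + ‖g i‖ ^ 2)) (fun A => by
      rw [mul_comm, ← tsum_mul_left]
      exact tsum_of_norm_bounded ((hf.add hg).mul_left ‖A‖).hasSum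
        fun _ => norm_inner_apply_le A _ _),
  ι, f, g, hf, hg, fun A => (summable_inner_apply hf hg A).hasSum⟩

theorem familyFunctional_hasSum (f g : ι → H) (hf : Summable fun i => ‖f i‖ ^ 2)
    (hg : Summable fun i => ‖g i‖ ^ 2) (A : H →L[ℂ] H) :
    HasSum (fun i => ⟪f i, A (g i)⟫_ℂ) ((familyFunctional f g hf hg).1 A) :=
  (summable_inner_apply hf hg A).hasSum

theorem familyFunctional_isPositive (f : ι → H) (hf : Summable fun i => ‖f i‖ ^ 2) :
    (familyFunctional f f hf hf).IsPositive := fun A hA =>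
  (familyFunctional_hasSum f f hf hf A).nonneg fun i => (nonneg_iff_inner A).1 hA (f i)

/-- The vector functional `A ↦ ⟪u, A v⟫`. -/
def vectorFunctional (u v : H) : Predual H :=
  familyFunctional (fun _ : Unit => u) (fun _ => v) (Summable.of_finite) (Summable.of_finite)

@[simp] theorem vectorFunctional_apply (u v : H) (A : H →L[ℂ] H) :
    (vectorFunctional u v).1 A = ⟪u, A v⟫_ℂ := by
  refine HasSum.unique (familyFunctional_hasSum _ _ _ _ A) ?_
  exact hasSum_unique (fun _ : Unit => ⟪u, A v⟫_ℂ)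

theorem eq_of_predual_eq {D D' : H →L[ℂ] H} (h : ∀ ρ : Predual H, ρ.1 D = ρ.1 D') : D = D' := by
  ext1 v
  refine ext_inner_left ℂ fun u => ?_
  simpa using h (vectorFunctional u v)

theorem vectorFunctional_isPositive (u : H) : (vectorFunctional u u).IsPositive :=
  familyFunctional_isPositive _ _

theorem inner_apply_polarization (A : H →L[ℂ] H) (u v : H) :
    ⟪u, A v⟫_ℂ =
      ((1 / 4) * ⟪u + (1 : ℂ) • v, A (u + (1 : ℂ) • v)⟫_ℂ +
        (-(1 / 4)) * ⟪u + (-1 : ℂ) • v, A (u + (-1 : ℂ) • v)⟫_ℂ) +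
      ((-Complex.I / 4) * ⟪u + Complex.I • v, A (u + Complex.I • v)⟫_ℂ +
        (Complex.I / 4) * ⟪u + (-Complex.I) • v, A (u + (-Complex.I) • v)⟫_ℂ) := by
  simp only [map_add, map_smul, inner_add_left, inner_add_right, inner_smul_left,
    inner_smul_right, map_one, map_neg, Complex.conj_I]
  linear_combination (-(1 / 2) * ⟪v, A u⟫_ℂ + (1 / 2) * ⟪u, A v⟫_ℂ) * Complex.I_sq

/-- Every normal functional is a linear combination of four positive ones of the form
`A ↦ ∑ᵢ ⟪fᵢ, A fᵢ⟫`. -/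
theorem exists_four_families (ρ : Predual H) :
    ∃ (ι : Type) (c : Fin 4 → ℂ) (f : Fin 4 → ι → H) (hf : ∀ k, Summable fun i => ‖f k i‖ ^ 2),
      ρ = ∑ k, c k • familyFunctional (f k) (f k) (hf k) (hf k) := by
  obtain ⟨ι, f, g, hf, hg, h⟩ := ρ.2
  have hs : ∀ c : ℂ, Summable fun i => ‖f i + c • g i‖ ^ 2 := fun c => by
    refine Summable.of_nonneg_of_le (fun i => by positivity) (fun i => ?_)
      ((hf.add (hg.mul_left (‖c‖ ^ 2))).mul_left 2)
    calc ‖f i + c • g i‖ ^ 2 ≤ (‖f i‖ + ‖c‖ * ‖g i‖) ^ 2 := by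
          gcongr; exact (norm_add_le _ _).trans (by rw [norm_smul])
      _ ≤ _ := by nlinarith [sq_nonneg (‖f i‖ - ‖c‖ * ‖g i‖)]
  refine ⟨ι, ![1 / 4, -(1 / 4), -Complex.I / 4, Complex.I / 4],
    fun k i => f i + ![1, -1, Complex.I, -Complex.I] k • g i, fun k => hs _, ?_⟩
  refine Predual.ext fun A => ?_
  refine (h A).unique ?_
  have h4 := fun c : ℂ => familyFunctional_hasSum _ _ (hs c) (hs c) A
  have := (((h4 1).mul_left (1 / 4)).add ((h4 (-1)).mul_left (-(1 / 4)))).add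
    (((h4 Complex.I).mul_left (-Complex.I / 4)).add ((h4 (-Complex.I)).mul_left (Complex.I / 4)))
  have e : ∀ i, ⟪f i, A (g i)⟫_ℂ = _ := fun i => inner_apply_polarization A (f i) (g i)
  simp only [e]
  refine (congrArg (HasSum _) ?_).mp this
  rw [Predual.sum_apply, Fin.sum_univ_four]
  simp only [Predual.smul_apply]
  exact (add_assoc _ _ _).symm

theorem eq_of_eq_on_isPositive {V : Type*} [AddCommGroup V] [Module ℂ V]
    {F G : Predual H →ₗ[ℂ] V} (h : ∀ ρ : Predual H, ρ.IsPositive → F ρ = G ρ) : F = G := by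
  ext ρ
  obtain ⟨ι, c, f, hf, rfl⟩ := exists_four_families ρ
  simp only [map_sum, map_smul]
  exact Finset.sum_congr rfl fun k _ => by rw [h _ (familyFunctional_isPositive _ _)]

theorem vectorFunctional_add_left (u u' v : H) :
    vectorFunctional (u + u') v = vectorFunctional u v + vectorFunctional u' v :=
  Predual.ext fun A => by simp

theorem vectorFunctional_add_right (u v v' : H) :
    vectorFunctional u (v + v') = vectorFunctional u v + vectorFunctional u v' :=
  Predual.ext fun A => by simp

theorem vectorFunctional_smul_left (c : ℂ) (u v : H) :
    vectorFunctional (c • u) v = (starRingEnd ℂ c) • vectorFunctional u v :=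
  Predual.ext fun A => by simp [mul_comm]

theorem vectorFunctional_smul_right (c : ℂ) (u v : H) :
    vectorFunctional u (c • v) = c • vectorFunctional u v :=
  Predual.ext fun A => by simp

variable [CompleteSpace H]

/-- A positive functional `F` on `B(H)_*` with `F(ρ) ≤ ρ(T)` for positive `ρ` is evaluation at
an operator. -/
theorem exists_eq_evalAt (F : Predual H →ₗ[ℂ] ℂ) (T : H →L[ℂ] H)
    (hF : ∀ ρ : Predual H, ρ.IsPositive → 0 ≤ F ρ)
    (hT : ∀ ρ : Predual H, ρ.IsPositive → F ρ ≤ ρ.1 T) :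
    ∃ D : H →L[ℂ] H, F = evalAt H D := by
  -- Positivity at `u + v` and `u + iv` makes the imaginary parts vanish, so the form is Hermitian
  -- and Cauchy–Schwarz applies.
  have hsymm : ∀ u v, starRingEnd ℂ (F (vectorFunctional u v)) = F (vectorFunctional v u) := by
    intro u v
    have h1 := (Complex.nonneg_iff.1 (hF _ (vectorFunctional_isPositive (u + v)))).2
    have h2 := (Complex.nonneg_iff.1 (hF _ (vectorFunctional_isPositive (u + Complex.I • v)))).2
    have h3 := (Complex.nonneg_iff.1 (hF _ (vectorFunctional_isPositive u))).2
    have h4 := (Complex.nonneg_iff.1 (hF _ (vectorFunctional_isPositive v))).2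
    simp only [vectorFunctional_add_left, vectorFunctional_add_right, vectorFunctional_smul_left,
      vectorFunctional_smul_right, map_add, map_smul, Complex.add_im, smul_eq_mul,
      Complex.conj_I, Complex.mul_im, Complex.mul_re, Complex.add_re, Complex.neg_re,
      Complex.neg_im, Complex.I_re, Complex.I_im] at h1 h2
    apply Complex.ext
    · rw [Complex.conj_re]; linarith
    · rw [Complex.conj_im]; linarith
  let core : PreInnerProductSpace.Core ℂ H :=
    { inner := fun u v => F (vectorFunctional u v)
      conj_inner_symm := fun u v => hsymm v u
      re_inner_nonneg := fun u => (Complex.nonneg_iff.1 (hF _ (vectorFunctional_isPositive u))).1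
      add_left := fun u v w => by rw [vectorFunctional_add_left, map_add]
      smul_left := fun u v c => by rw [vectorFunctional_smul_left, map_smul, smul_eq_mul] }
  have hdiag : ∀ u, (F (vectorFunctional u u)).re ≤ ‖T‖ * ‖u‖ ^ 2 := fun u => by
    have h1 := (Complex.le_def.1 (hT _ (vectorFunctional_isPositive u))).1
    refine h1.trans ((Complex.re_le_norm _).trans ?_)
    rw [vectorFunctional_apply]
    refine (norm_inner_le_norm _ _).trans ?_
    calc ‖u‖ * ‖T u‖ ≤ ‖u‖ * (‖T‖ * ‖u‖) := by gcongr; exact T.le_opNorm _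
      _ = _ := by ring
  have hCS : ∀ u v, ‖F (vectorFunctional u v)‖ ≤ ‖T‖ * ‖u‖ * ‖v‖ := fun u v => by
    have h1 : ‖F (vectorFunctional u v)‖ * ‖F (vectorFunctional v u)‖ ≤
        (F (vectorFunctional u u)).re * (F (vectorFunctional v v)).re :=
      InnerProductSpace.Core.inner_mul_inner_self_le (c := core) u v
    rw [← hsymm u v, RCLike.norm_conj] at h1
    refine abs_le_of_sq_le_sq' ?_ (by positivity) |>.2
    calc _ = ‖F (vectorFunctional u v)‖ * ‖F (vectorFunctional u v)‖ := by ring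
      _ ≤ _ := h1
      _ ≤ (‖T‖ * ‖u‖ ^ 2) * (‖T‖ * ‖v‖ ^ 2) := by
        gcongr
        · exact (Complex.nonneg_iff.1 (hF _ (vectorFunctional_isPositive v))).1
        · exact hdiag u
        · exact hdiag v
      _ = _ := by ring
  let B : H →L⋆[ℂ] H →L[ℂ] ℂ := LinearMap.mkContinuous₂
    (LinearMap.mk₂'ₛₗ (starRingEnd ℂ) (RingHom.id ℂ) (fun u v => F (vectorFunctional u v))
      (fun u u' v => by rw [vectorFunctional_add_left, map_add])
      (fun c u v => by rw [vectorFunctional_smul_left, map_smul])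
      (fun u v v' => by rw [vectorFunctional_add_right, map_add])
      (fun c u v => by rw [vectorFunctional_smul_right, map_smul]; rfl)) ‖T‖ hCS
  -- Riesz representation of the bounded form. So far `D` represents `F` on vector functionals only.
  set D : H →L[ℂ] H :=
    ContinuousLinearMap.adjoint (InnerProductSpace.continuousLinearMapOfBilin B) with hD
  have hDv : ∀ u v, ⟪u, D v⟫_ℂ = F (vectorFunctional u v) := fun u v => by
    rw [hD, ContinuousLinearMap.adjoint_inner_right,
      InnerProductSpace.continuousLinearMapOfBilin_apply]
    rfl
  refine ⟨D, ?_⟩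
  -- The passage to infinite sums: `F` carries no continuity assumption, and domination by `T`
  -- replaces it.
  have key : ∀ (ι : Type) (w : ι → H) (hw : Summable fun i => ‖w i‖ ^ 2),
      F (familyFunctional w w hw hw) = (familyFunctional w w hw hw).1 D := by
    intro ι w hw
    refine HasSum.unique ?_ (familyFunctional_hasSum w w hw hw D)
    set σ := familyFunctional w w hw hw with hσ
    have hfin : ∀ s : Finset ι,
        (σ - ∑ i ∈ s, vectorFunctional (w i) (w i)).IsPositive := fun s A hA => by
      have e : (σ - ∑ i ∈ s, vectorFunctional (w i) (w i)).1 A =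
          σ.1 A - ∑ i ∈ s, ⟪w i, A (w i)⟫_ℂ := by
        simp [Predual.sum_apply]
      rw [e, sub_nonneg]
      exact sum_le_hasSum s (fun i _ => (nonneg_iff_inner A).1 hA (w i))
        (familyFunctional_hasSum w w hw hw A)
    have htail : Tendsto (fun s : Finset ι => σ.1 T - ∑ i ∈ s, ⟪w i, T (w i)⟫_ℂ) atTop (𝓝 0) := by
      rw [← sub_self (σ.1 T)]
      refine tendsto_const_nhds.sub ?_
      simpa [HasSum] using familyFunctional_hasSum w w hw hw T
    -- `F` of the tail lies between `0` and the tail evaluated at `T`, which tends to zero.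
    have hrem : Tendsto (fun s : Finset ι => F σ - ∑ i ∈ s, ⟪w i, D (w i)⟫_ℂ) atTop (𝓝 0) := by
      refine squeeze_zero_norm (fun s => ?_) (tendsto_zero_iff_norm_tendsto_zero.1 htail)
      have h1 := hF _ (hfin s)
      have h2 := hT _ (hfin s)
      have e : F (σ - ∑ i ∈ s, vectorFunctional (w i) (w i)) =
          F σ - ∑ i ∈ s, ⟪w i, D (w i)⟫_ℂ := by simp [hDv]
      have e' : (σ - ∑ i ∈ s, vectorFunctional (w i) (w i)).1 T =
          σ.1 T - ∑ i ∈ s, ⟪w i, T (w i)⟫_ℂ := by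
        simp [Predual.sum_apply]
      rw [e] at h1 h2
      rw [e'] at h2
      exact CStarAlgebra.norm_le_norm_of_nonneg_of_le h1 h2
    have := tendsto_const_nhds (x := F σ) |>.sub hrem
    simpa [HasSum] using this
  ext ρ
  obtain ⟨ι, c, f, hf, rfl⟩ := exists_four_families ρ
  rw [map_sum, map_sum]
  refine Finset.sum_congr rfl fun k _ => ?_
  rw [map_smul, map_smul, key]
  rfl

end Families

/-! ### Multiplication operators and truncations -/

section Multiplication

variable {K : Type*} [NormedAddCommGroup K] [InnerProductSpace ℂ K]

theorem lam_nonneg {A : K →L[ℂ] K} (hA : 0 ≤ A) : 0 ≤ lam A := by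
  rw [nonneg_iff_inner]
  intro f
  rw [L2.inner_def]
  refine integral_nonneg_of_ae ?_
  filter_upwards [lam_apply A f] with x hx
  rw [hx, inner_smul_right]
  exact mul_nonneg (by exact_mod_cast (Real.exp_pos _).le) ((nonneg_iff_inner A).1 hA _)

theorem lam_mono [CompleteSpace K] {A B : K →L[ℂ] K} (h : A ≤ B) : lam A ≤ lam B := by
  rw [← sub_nonneg, ← map_sub]
  exact lam_nonneg (sub_nonneg.2 h)

theorem inner_mulOp_left {g : ℝ → ℝ} (hg : MemLp (fun x => (g x : ℂ)) ∞ halfLine) (f f' : HL K) :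
    ⟪mulOp hg f, f'⟫_ℂ = ⟪f, mulOp hg f'⟫_ℂ := by
  rw [L2.inner_def, L2.inner_def]
  refine integral_congr_ae ?_
  filter_upwards [mulOp_coe hg f, mulOp_coe hg f'] with x h1 h2
  rw [h1, h2, inner_smul_left, inner_smul_right, Complex.conj_ofReal]

theorem mulOp_comm_lam {g : ℝ → ℂ} (hg : MemLp g ∞ halfLine) (A : K →L[ℂ] K) :
    mulOp hg * lam A = lam A * mulOp hg := by
  ext1 f
  apply Lp.ext
  have h3 := mulOp_coe hg (lam A f)
  have h4 := lam_apply A (mulOp hg f)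
  filter_upwards [mulOp_coe hg f, lam_apply A f, h3, h4] with x h1 h2 h3 h4
  rw [mul_apply_eq_comp, mul_apply_eq_comp, h3, h4, h1, h2, map_smul, smul_comm]

theorem cutOp_mul_cutOp (s t : ℝ) : cutOp K s * cutOp K t = cutOp K (max s t) := by
  refine mulOp_mul _ _ _ fun x _ => ?_
  rw [← Complex.ofReal_mul]
  congr 1
  by_cases h1 : s < x <;> by_cases h2 : t < x <;>
    simp [Set.indicator, h1, h2]

theorem cutOp_comm_lam (t : ℝ) (A : K →L[ℂ] K) : cutOp K t * lam A = lam A * cutOp K t :=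
  mulOp_comm_lam _ A

theorem cutOp_comm_rootOp (t : ℝ) : cutOp K t * rootOp K = rootOp K * cutOp K t := by
  ext1 f
  apply Lp.ext
  have h3 := mulOp_coe (memLp_ind t) (rootOp K f)
  have h4 := mulOp_coe memLp_root (cutOp K t f)
  filter_upwards [mulOp_coe (memLp_ind t) f, mulOp_coe memLp_root f, h3, h4] with x h1 h2 h3 h4
  rw [mul_apply_eq_comp, mul_apply_eq_comp]
  change (mulOp (memLp_ind t) (rootOp K f)) x = (mulOp memLp_root (cutOp K t f)) x
  rw [h3, h4]
  change _ • (mulOp memLp_root f) x = _ • (mulOp (memLp_ind t) f) x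
  rw [h1, h2, smul_comm]

theorem inner_cutOp_left (t : ℝ) (f f' : HL K) : ⟪cutOp K t f, f'⟫_ℂ = ⟪f, cutOp K t f'⟫_ℂ :=
  inner_mulOp_left _ f f'

/-- This filter is `t → 0+`; it is proper because `0` is in the closure of `(0, ∞)`. -/
instance neBot_comap_val_nhds_zero :
    (comap (Subtype.val : Set.Ioi (0 : ℝ) → ℝ) (𝓝 0)).NeBot := by
  rw [← mem_closure_iff_comap_neBot, closure_Ioi]
  exact Set.self_mem_Ici

theorem eventually_val_lt {x : ℝ} (hx : 0 < x) :
    ∀ᶠ t : Set.Ioi (0 : ℝ) in comap Subtype.val (𝓝 0), t.1 < x :=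
  (eventually_lt_nhds hx).comap _

theorem tendsto_inner_cutOp (f : HL K) :
    Tendsto (fun t : Set.Ioi (0 : ℝ) => ⟪f, cutOp K t f⟫_ℂ) (comap Subtype.val (𝓝 0))
      (𝓝 ⟪f, f⟫_ℂ) := by
  have e : ∀ t : Set.Ioi (0 : ℝ), ⟪f, cutOp K t f⟫_ℂ =
      ∫ x, (((Set.Ioi t.1).indicator (fun _ => (1 : ℝ)) x : ℝ) : ℂ) * ⟪f x, f x⟫_ℂ ∂halfLine := by
    intro t
    rw [L2.inner_def]
    refine integral_congr_ae ?_
    filter_upwards [mulOp_coe (memLp_ind t) f] with x hx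
    change ⟪f x, (mulOp (memLp_ind t) f) x⟫_ℂ = _
    rw [hx, inner_smul_right]
  simp only [e]
  rw [L2.inner_def]
  refine tendsto_integral_filter_of_dominated_convergence (fun x => ‖⟪f x, f x⟫_ℂ‖)
    (Eventually.of_forall fun t => ?_)
    (Eventually.of_forall fun t => Eventually.of_forall fun x => ?_)
    (L2.integrable_inner f f).norm ?_
  · exact (memLp_ind t).aestronglyMeasurable.mul (L2.integrable_inner f f).aestronglyMeasurable
  · rw [norm_mul]
    refine mul_le_of_le_one_left (norm_nonneg _) ?_
    by_cases h : t.1 < x <;> simp [Set.indicator, h]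
  · filter_upwards [ae_restrict_mem (measurableSet_Ioi (a := (0 : ℝ)))] with x hx
    refine tendsto_const_nhds.congr' ?_
    filter_upwards [eventually_val_lt hx] with t ht
    simp [Set.indicator, ht]

theorem cutOp_cutOp_self (t : ℝ) (f : HL K) : cutOp K t (cutOp K t f) = cutOp K t f := by
  rw [← mul_apply_eq_comp, cutOp_mul_cutOp, max_self]

theorem norm_cutOp_apply_le (t : ℝ) (f : HL K) : ‖cutOp K t f‖ ≤ ‖f‖ := by
  have h : ‖cutOp K t f‖ ^ 2 ≤ ‖f‖ * ‖cutOp K t f‖ := by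
    have h1 : ⟪cutOp K t f, cutOp K t f⟫_ℂ = ⟪f, cutOp K t f⟫_ℂ := by
      rw [inner_cutOp_left, cutOp_cutOp_self]
    rw [← inner_self_eq_norm_sq (𝕜 := ℂ), h1]
    exact (RCLike.re_le_norm _).trans (norm_inner_le_norm _ _)
  by_contra! hlt
  nlinarith [norm_nonneg f]

theorem tendsto_cutOp (f : HL K) :
    Tendsto (fun t : Set.Ioi (0 : ℝ) => cutOp K t f) (comap Subtype.val (𝓝 0)) (𝓝 f) := by
  rw [tendsto_iff_norm_sub_tendsto_zero]
  -- For projections, weak convergence to the identity implies strong convergence.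
  have h1 : ∀ t : Set.Ioi (0 : ℝ), ‖cutOp K t f - f‖ ^ 2 = (⟪f, f⟫_ℂ - ⟪f, cutOp K t f⟫_ℂ).re := by
    intro t
    have h2 : ⟪cutOp K t f, cutOp K t f⟫_ℂ = ⟪f, cutOp K t f⟫_ℂ := by
      rw [inner_cutOp_left, cutOp_cutOp_self]
    rw [← inner_self_eq_norm_sq (𝕜 := ℂ), inner_sub_left, inner_sub_right, inner_sub_right, h2,
      inner_cutOp_left, RCLike.re_to_complex]
    congr 1
    ring
  have h3 : Tendsto (fun t : Set.Ioi (0 : ℝ) => ‖cutOp K t f - f‖ ^ 2) (comap Subtype.val (𝓝 0))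
      (𝓝 0) := by
    simp only [h1]
    have h4 := (tendsto_const_nhds (x := ⟪f, f⟫_ℂ)).sub (tendsto_inner_cutOp f)
    rw [sub_self] at h4
    exact (Complex.continuous_re.tendsto 0).comp h4
  have h5 := (Real.continuous_sqrt.tendsto 0).comp h3
  simpa [Function.comp_def, Real.sqrt_sq (norm_nonneg _)] using h5

/-- The cut-offs converge to `I` only strongly; normality turns this into convergence of values, by
dominated convergence in the defining series. -/
theorem tendsto_predual_cutOp (ρ : Predual (HL K)) (A : HL K →L[ℂ] HL K) :
    Tendsto (fun t : Set.Ioi (0 : ℝ) => ρ.1 (cutOp K t * A * cutOp K t))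
      (comap Subtype.val (𝓝 0)) (𝓝 (ρ.1 A)) := by
  obtain ⟨ι, f, g, hf, hg, h⟩ := ρ.2
  have e : ∀ B, ρ.1 B = ∑' i, ⟪f i, B (g i)⟫_ℂ := fun B => (h B).tsum_eq.symm
  simp only [e]
  refine tendsto_tsum_of_dominated_convergence ((hf.add hg).mul_left ‖A‖) (fun i => ?_)
    (Eventually.of_forall fun t i => ?_)
  · have h1 : ∀ t : Set.Ioi (0 : ℝ), ⟪f i, (cutOp K t * A * cutOp K t) (g i)⟫_ℂ =
        ⟪cutOp K t (f i), A (cutOp K t (g i))⟫_ℂ := fun t => (inner_cutOp_left _ _ _).symm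
    simp only [h1]
    exact (tendsto_cutOp (f i)).inner ((A.continuous.tendsto _).comp (tendsto_cutOp (g i)))
  · have h1 : ⟪f i, (cutOp K t * A * cutOp K t) (g i)⟫_ℂ =
        ⟪cutOp K t (f i), A (cutOp K t (g i))⟫_ℂ := (inner_cutOp_left _ _ _).symm
    rw [h1]
    refine (norm_inner_apply_le A _ _).trans ?_
    gcongr <;> exact norm_cutOp_apply_le _ _

variable [CompleteSpace K]

theorem isSelfAdjoint_cutOp (t : ℝ) : IsSelfAdjoint (cutOp K t) := by
  rw [ContinuousLinearMap.isSelfAdjoint_iff_isSymmetric]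
  exact fun f f' => inner_cutOp_left t f f'

theorem isSelfAdjoint_rootOp : IsSelfAdjoint (rootOp K) := by
  rw [ContinuousLinearMap.isSelfAdjoint_iff_isSymmetric]
  exact fun f f' => inner_mulOp_left _ f f'

theorem lam_one_le_one : lam (1 : K →L[ℂ] K) ≤ 1 := by
  rw [← sub_nonneg, ← rootOp_mul_rootOp]
  simpa using sandwich_nonneg (A := 1) (isSelfAdjoint_rootOp (K := K)) zero_le_one

/-! ### Positivity of truncations -/

/-- The truncation `μ|ₜ` as a plain function of `t` and `μ`. -/
def trunc (t : Set.Ioi (0 : ℝ)) (μ : boundaryWeights K) : Predual (HL K) := truncate t μ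

theorem truncate_eq_trunc (t : Set.Ioi (0 : ℝ)) (μ : boundaryWeights K) :
    truncate t μ = trunc t μ := rfl

theorem trunc_smul (t : Set.Ioi (0 : ℝ)) (c : ℂ) (μ : boundaryWeights K) :
    trunc t (c • μ) = c • trunc t μ := (truncate t).map_smul c μ

theorem trunc_zero (t : Set.Ioi (0 : ℝ)) : trunc t (0 : boundaryWeights K) = 0 :=
  (truncate t).map_zero

theorem trunc_apply (t : Set.Ioi (0 : ℝ)) (μ : boundaryWeights K) (A : HL K →L[ℂ] HL K) :
    (trunc t μ).1 A = μ.1 (cutMap t A) := rfl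

theorem trunc_isPositive {μ : boundaryWeights K} (hμ : IsPositiveWeight μ)
    (t : Set.Ioi (0 : ℝ)) : (trunc t μ).IsPositive := fun A hA =>
  hμ (cutMap t A) (sandwich_nonneg (isSelfAdjoint_cutOp _) hA)

theorem lamHat_isPositive {η : Predual (HL K)} (hη : η.IsPositive) : (lamHat K η).IsPositive :=
  fun _ hA => hη _ (lam_nonneg hA)

/-- Truncations are consistent because `E(s, ∞) E(t, ∞) = E(t, ∞)` for `s ≤ t`. -/
theorem trunc_apply_of_le {s t : Set.Ioi (0 : ℝ)} (h : s ≤ t) (μ : boundaryWeights K)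
    (A : HL K →L[ℂ] HL K) :
    (trunc t μ).1 A = (trunc s μ).1 (cutOp K t * A * cutOp K t) := by
  rw [trunc_apply, trunc_apply]
  congr 1
  refine Subtype.ext ?_
  change cutOp K t * A * cutOp K t =
    cutOp K s * (cutOp K t * A * cutOp K t) * cutOp K s
  have h1 : cutOp K s * cutOp K t = cutOp K t := by rw [cutOp_mul_cutOp, max_eq_right (show s.1 ≤ t.1 from h)]
  have h2 : cutOp K t * cutOp K s = cutOp K t := by rw [cutOp_mul_cutOp, max_eq_left (show s.1 ≤ t.1 from h)]
  calc _ = (cutOp K s * cutOp K t) * A * (cutOp K t * cutOp K s) := by rw [h1, h2]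
    _ = _ := by simp only [mul_assoc]

/-- `E(t, ∞)` commutes with `(I - Λ)^{1/2}`, so truncating `μ` amounts to cutting off the argument
of the normal functional behind it. Hence statements about truncations determine the weight. -/
theorem tendsto_trunc_apply (μ : boundaryWeights K) (B : boundaryAlgebra K) :
    Tendsto (fun t : Set.Ioi (0 : ℝ) => (trunc t μ).1 B.1) (comap Subtype.val (𝓝 0))
      (𝓝 (μ.1 B)) := by
  obtain ⟨ℓ, hℓ⟩ := μ.2
  obtain ⟨A, hA⟩ := B.2
  have e0 : ℓ.1 A = μ.1 B := (hℓ A).trans (congrArg μ.1 (Subtype.ext hA))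
  have hA' : rootOp K * A * rootOp K = B.1 := hA
  have e : ∀ t : Set.Ioi (0 : ℝ), ℓ.1 (cutOp K t * A * cutOp K t) = (trunc t μ).1 B.1 := by
    intro t
    refine (hℓ _).trans (congrArg μ.1 (Subtype.ext ?_))
    change rootOp K * (cutOp K t * A * cutOp K t) * rootOp K = cutOp K t * B.1 * cutOp K t
    calc _ = (rootOp K * cutOp K t) * A * (cutOp K t * rootOp K) := by simp only [mul_assoc]
      _ = (cutOp K t * rootOp K) * A * (rootOp K * cutOp K t) := by rw [cutOp_comm_rootOp]
      _ = cutOp K t * (rootOp K * A * rootOp K) * cutOp K t := by simp only [mul_assoc]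
      _ = _ := by rw [hA']
  rw [← e0]
  simp only [← e]
  exact tendsto_predual_cutOp ℓ A

/-- A boundary weight is determined by its truncations. -/
theorem eq_of_trunc_eq {μ ν : boundaryWeights K} (h : ∀ t, trunc t μ = trunc t ν) :
    μ = ν := by
  refine Subtype.ext (LinearMap.ext fun B => ?_)
  refine tendsto_nhds_unique (tendsto_trunc_apply μ B) ?_
  simp only [h]
  exact tendsto_trunc_apply ν B

theorem trunc_sub_trunc {s t : Set.Ioi (0 : ℝ)} (h : s ≤ t) (μ : boundaryWeights K)
    (A : HL K →L[ℂ] HL K) :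
    (trunc s μ).1 A - (trunc t μ).1 A =
      (trunc s μ).1 (A - cutOp K t * A * cutOp K t) := by
  rw [trunc_apply_of_le h, Predual.map_sub]

/-- For `A` commuting with the cut-off the difference is the compression `(1 - E) A (1 - E)`. This
is the source of monotonicity in `t` for operators such as `Λ(A)` and `I - Λ(T)`. -/
theorem sub_cut_nonneg {A : HL K →L[ℂ] HL K} (hA : 0 ≤ A) {t : ℝ}
    (hc : cutOp K t * A = A * cutOp K t) : 0 ≤ A - cutOp K t * A * cutOp K t := by
  have h1 : cutOp K t * cutOp K t = cutOp K t := by rw [cutOp_mul_cutOp, max_self]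
  have h2 : A - cutOp K t * A * cutOp K t = (1 - cutOp K t) * A * (1 - cutOp K t) := by
    rw [hc, mul_assoc, h1]
    have h3 : cutOp K t * A * cutOp K t = A * cutOp K t := by rw [hc, mul_assoc, h1]
    calc _ = A - A * cutOp K t - A * cutOp K t + cutOp K t * A * cutOp K t := by rw [h3]; abel
      _ = A - A * cutOp K t - cutOp K t * A + cutOp K t * A * cutOp K t := by rw [hc]
      _ = _ := by noncomm_ring
  rw [h2]
  exact sandwich_nonneg ((IsSelfAdjoint.one _).sub (isSelfAdjoint_cutOp t)) hA

end Multiplication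

/-! ### Complete positivity of rank one maps -/

section SchurProduct

open scoped MatrixOrder in
theorem exists_gram_of_nonneg {n : ℕ} (m : Fin n → Fin n → ℂ)
    (h : ∀ c : Fin n → ℂ, 0 ≤ ∑ i, ∑ j, starRingEnd ℂ (c i) * c j * m i j) :
    ∃ B : Fin n → Fin n → ℂ, ∀ i j, m i j = ∑ k, starRingEnd ℂ (B k i) * B k j := by
  have hM : (Matrix.of m).PosSemidef := by
    rw [← Matrix.isPositive_toEuclideanLin_iff, LinearMap.isPositive_iff_complex]
    intro x
    -- The conjugate appears because here the matrix acts in the first, conjugate-linear slot.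
    have e : ⟪Matrix.toEuclideanLin (Matrix.of m) x, x⟫_ℂ =
        starRingEnd ℂ (∑ i, ∑ j, starRingEnd ℂ (x i) * x j * m i j) := by
      rw [PiLp.inner_apply, map_sum]
      refine Finset.sum_congr rfl fun i _ => ?_
      rw [RCLike.inner_apply, Matrix.toLpLin_apply]
      simp only [Matrix.mulVec, dotProduct, Matrix.of_apply, map_sum, map_mul, Complex.conj_conj]
      rw [Finset.mul_sum]
      refine Finset.sum_congr rfl fun j _ => ?_
      ring
    have h1 := Complex.nonneg_iff.1 (h x)
    rw [e]
    refine ⟨Complex.ext rfl ?_, ?_⟩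
    · simp only [Complex.conj_im, ← h1.2]; simp
    · exact h1.1
  obtain ⟨B, hB⟩ := CStarAlgebra.nonneg_iff_eq_star_mul_self.mp hM.nonneg
  refine ⟨B, fun i j => ?_⟩
  have := congrFun (congrFun hB i) j
  simpa [Matrix.mul_apply, Matrix.star_eq_conjTranspose] using this

/-- With `m = B* B` the quadratic form splits into `∑ₖ ⟪wₖ, D wₖ⟫`, where `wₖ = ∑ᵢ Bₖᵢ vᵢ`. -/
theorem isPositiveMatrix_smul {K : Type*} [NormedAddCommGroup K] [InnerProductSpace ℂ K]
    {n : ℕ} {m : Fin n → Fin n → ℂ}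
    (h : ∀ c : Fin n → ℂ, 0 ≤ ∑ i, ∑ j, starRingEnd ℂ (c i) * c j * m i j)
    {D : K →L[ℂ] K} (hD : 0 ≤ D) : IsPositiveMatrix (fun i j => m i j • D) := by
  obtain ⟨B, hB⟩ := exists_gram_of_nonneg m h
  intro v
  have e : ∑ i, ∑ j, ⟪v i, (m i j • D) (v j)⟫_ℂ =
      ∑ k, ⟪∑ i, B k i • v i, D (∑ j, B k j • v j)⟫_ℂ := by
    simp only [hB, map_sum, sum_inner, inner_sum, map_smul, inner_smul_left, inner_smul_right,
      _root_.smul_apply, Finset.sum_mul]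
    calc _ = ∑ i, ∑ k, ∑ j, starRingEnd ℂ (B k i) * B k j * ⟪v i, D (v j)⟫_ℂ :=
          Finset.sum_congr rfl fun i _ => Finset.sum_comm
      _ = ∑ k, ∑ i, ∑ j, starRingEnd ℂ (B k i) * B k j * ⟪v i, D (v j)⟫_ℂ := Finset.sum_comm
      _ = ∑ k, ∑ j, ∑ i, starRingEnd ℂ (B k i) * B k j * ⟪v i, D (v j)⟫_ℂ :=
          Finset.sum_congr rfl fun k _ => Finset.sum_comm
      _ = _ := by
          refine Finset.sum_congr rfl fun k _ => ?_
          refine Finset.sum_congr rfl fun j _ => ?_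
          rw [Finset.mul_sum]
          exact Finset.sum_congr rfl fun i _ => by ring
  rw [e]
  exact Finset.sum_nonneg fun k _ => (nonneg_iff_inner D).1 hD _

theorem sum_smul_nonneg_of_isPositiveMatrix {H : Type*} [NormedAddCommGroup H]
    [InnerProductSpace ℂ H] {n : ℕ} {T : Fin n → Fin n → (H →L[ℂ] H)} (hT : IsPositiveMatrix T)
    (c : Fin n → ℂ) : 0 ≤ ∑ i, ∑ j, (starRingEnd ℂ (c i) * c j) • T i j := by
  rw [nonneg_iff_inner]
  intro x
  have := hT fun i => c i • x
  simpa [_root_.sum_apply, inner_sum, inner_smul_left, inner_smul_right, mul_assoc,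
    mul_left_comm, mul_comm] using this

/-- Applying `φ` entrywise to a positive operator matrix gives a positive semidefinite scalar
matrix; times `D` this is again a positive operator matrix, on which the given matrix of functionals
is nonnegative. -/
theorem isCompletelyPositive_smulRight {K H : Type*} [NormedAddCommGroup K] [InnerProductSpace ℂ K]
    [NormedAddCommGroup H] [InnerProductSpace ℂ H] {D : K →L[ℂ] K} (hD : 0 ≤ D)
    {φ : Predual H} (hφ : φ.IsPositive) :
    IsCompletelyPositive ((evalAt K D).smulRight φ) := by
  intro n ρ hρ T hT
  have h1 : ∀ c : Fin n → ℂ, 0 ≤ ∑ i, ∑ j, starRingEnd ℂ (c i) * c j * φ.1 (T i j) := fun c => by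
    have := hφ _ (sum_smul_nonneg_of_isPositiveMatrix hT c)
    simpa [map_sum] using this
  have := hρ _ (isPositiveMatrix_smul h1 hD)
  refine this.trans_eq (Finset.sum_congr rfl fun i _ => Finset.sum_congr rfl fun j _ => ?_)
  rw [Predual.map_smul, mul_comm]
  rfl

end SchurProduct

/-! ### Generalized boundary representations -/

section BoundaryRep

variable {K : Type*} [NormedAddCommGroup K] [InnerProductSpace ℂ K]

/-- The boundary weight map `ρ ↦ f(ρ) ν`. -/
def rankOneMap (f : Predual K →ₗ[ℂ] ℂ) (ν : boundaryWeights K) : BoundaryWeightMap K :=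
  f.smulRight ν

theorem rankOneMap_apply (f : Predual K →ₗ[ℂ] ℂ) (ν : boundaryWeights K) (ρ : Predual K) :
    rankOneMap f ν ρ = f ρ • ν := rfl

theorem rankOneMap_evalAt_completelyPositive {D : K →L[ℂ] K} (hD : 0 ≤ D)
    {ν : boundaryWeights K} (hν : IsPositiveWeight ν) :
    IsCompletelyPositiveWeightMap (rankOneMap (evalAt K D) ν) := by
  intro n ρ hρ T hT
  have h1 : ∀ c : Fin n → ℂ, 0 ≤ ∑ i, ∑ j, starRingEnd ℂ (c i) * c j * ν.1 (T i j) := fun c => by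
    have h2 : (0 : HL K →L[ℂ] HL K) ≤
        (∑ i, ∑ j, (starRingEnd ℂ (c i) * c j) • T i j : boundaryAlgebra K).1 := by
      have := sum_smul_nonneg_of_isPositiveMatrix hT c
      refine this.trans_eq ?_
      rw [AddSubmonoidClass.coe_finsetSum]
      refine Finset.sum_congr rfl fun i _ => ?_
      rw [AddSubmonoidClass.coe_finsetSum]
      rfl
    have := hν _ h2
    rw [map_sum] at this
    simp only [map_sum, map_smul, smul_eq_mul] at this
    exact this
  have := hρ _ (isPositiveMatrix_smul h1 hD)
  refine this.trans_eq (Finset.sum_congr rfl fun i _ => Finset.sum_congr rfl fun j _ => ?_)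
  rw [Predual.map_smul, mul_comm]
  rfl

variable [CompleteSpace K]

theorem onePlus_apply (ω : BoundaryWeightMap K) (t : Set.Ioi (0 : ℝ)) (ρ : Predual K) :
    onePlus ω t ρ = ρ + lamHat K (trunc t (ω ρ)) := rfl

theorem boundaryRep_apply (ω : BoundaryWeightMap K) (t : Set.Ioi (0 : ℝ)) (ρ : Predual K) :
    boundaryRep ω t ρ = trunc t (ω (Ring.inverse (onePlus ω t) ρ)) := rfl

theorem inverse_onePlus_apply_onePlus {ω : BoundaryWeightMap K} {t : Set.Ioi (0 : ℝ)}
    (h : IsUnit (onePlus ω t)) (ρ : Predual K) :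
    Ring.inverse (onePlus ω t) (onePlus ω t ρ) = ρ :=
  LinearMap.congr_fun (Ring.inverse_mul_cancel _ h) ρ

theorem onePlus_apply_inverse_onePlus {ω : BoundaryWeightMap K} {t : Set.Ioi (0 : ℝ)}
    (h : IsUnit (onePlus ω t)) (ρ : Predual K) :
    onePlus ω t (Ring.inverse (onePlus ω t) ρ) = ρ :=
  LinearMap.congr_fun (Ring.mul_inverse_cancel _ h) ρ

theorem boundaryRep_apply_onePlus {ω : BoundaryWeightMap K} {t : Set.Ioi (0 : ℝ)}
    (h : IsUnit (onePlus ω t)) (ρ : Predual K) :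
    boundaryRep ω t (onePlus ω t ρ) = trunc t (ω ρ) := by
  rw [boundaryRep_apply, inverse_onePlus_apply_onePlus h]

/-- The inverse is `I - Λ̂π̂ₜ`, so it can be read off from the boundary representation alone. -/
theorem inverse_onePlus_apply {ω : BoundaryWeightMap K} {t : Set.Ioi (0 : ℝ)}
    (h : IsUnit (onePlus ω t)) (ρ : Predual K) :
    Ring.inverse (onePlus ω t) ρ = ρ - lamHat K (boundaryRep ω t ρ) := by
  have h1 := onePlus_apply_inverse_onePlus h ρ
  rw [onePlus_apply, ← boundaryRep_apply] at h1
  exact eq_sub_of_add_eq h1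

/-- A boundary weight map is determined by its generalized boundary representation. -/
theorem eq_of_boundaryRep_eq {ω η : BoundaryWeightMap K} (hω : ∀ t, IsUnit (onePlus ω t))
    (hη : ∀ t, IsUnit (onePlus η t)) (h : ∀ t, boundaryRep ω t = boundaryRep η t) : ω = η := by
  refine LinearMap.ext fun ρ => eq_of_trunc_eq fun t => ?_
  have e : onePlus ω t ρ = onePlus η t ρ := by
    have h1 : Ring.inverse (onePlus η t) (onePlus ω t ρ) = ρ := by
      rw [inverse_onePlus_apply (hη t), ← h t, ← inverse_onePlus_apply (hω t),
        inverse_onePlus_apply_onePlus (hω t)]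
    rw [← onePlus_apply_inverse_onePlus (hη t) (onePlus ω t ρ), h1]
  rw [← boundaryRep_apply_onePlus (hω t), ← boundaryRep_apply_onePlus (hη t), e, h t]

theorem trunc_rankOneMap (f : Predual K →ₗ[ℂ] ℂ) (ν : boundaryWeights K) (t : Set.Ioi (0 : ℝ))
    (ρ : Predual K) : trunc t (rankOneMap f ν ρ) = f ρ • trunc t ν := trunc_smul t (f ρ) ν

theorem onePlus_rankOneMap (f : Predual K →ₗ[ℂ] ℂ) (ν : boundaryWeights K) (t : Set.Ioi (0 : ℝ))
    (ρ : Predual K) : onePlus (rankOneMap f ν) t ρ = ρ + f ρ • lamHat K (trunc t ν) := by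
  rw [onePlus_apply, trunc_rankOneMap, map_smul]

/-- Sherman–Morrison: a perturbation `ρ ↦ ρ + f(ρ) σ` of the identity has inverse `ρ ↦ ρ - f(ρ) (1 +
f(σ))⁻¹ σ`. -/
theorem isUnit_onePlus_rankOneMap {f : Predual K →ₗ[ℂ] ℂ} {ν : boundaryWeights K}
    {t : Set.Ioi (0 : ℝ)} (h : 1 + f (lamHat K (trunc t ν)) ≠ 0) :
    IsUnit (onePlus (rankOneMap f ν) t) := by
  set σ := lamHat K (trunc t ν) with hσ
  let N : Module.End ℂ (Predual K) := 1 - f.smulRight ((1 + f σ)⁻¹ • σ)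
  have hN : ∀ ρ, N ρ = ρ - f ρ • ((1 + f σ)⁻¹ • σ) := fun ρ => rfl
  refine ⟨⟨onePlus (rankOneMap f ν) t, N, LinearMap.ext fun ρ => ?_, LinearMap.ext fun ρ => ?_⟩,
    rfl⟩
  · change onePlus (rankOneMap f ν) t (N ρ) = ρ
    rw [onePlus_rankOneMap, hN, ← hσ, map_sub, map_smul, map_smul, smul_eq_mul, smul_eq_mul,
      smul_smul, sub_add, ← sub_smul]
    have : f ρ * (1 + f σ)⁻¹ - (f ρ - f ρ * ((1 + f σ)⁻¹ * f σ)) = 0 := by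
      field_simp; ring
    rw [this, zero_smul, sub_zero]
  · change N (onePlus (rankOneMap f ν) t ρ) = ρ
    rw [onePlus_rankOneMap, hN, ← hσ, map_add, map_smul, smul_eq_mul, smul_smul, add_sub_assoc,
      ← sub_smul]
    have : f ρ - (f ρ + f ρ * f σ) * (1 + f σ)⁻¹ = 0 := by
      field_simp; ring
    rw [this, zero_smul, add_zero]

theorem boundaryRep_rankOneMap {f : Predual K →ₗ[ℂ] ℂ} {ν : boundaryWeights K}
    {t : Set.Ioi (0 : ℝ)} (h : 1 + f (lamHat K (trunc t ν)) ≠ 0) (ρ : Predual K) :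
    boundaryRep (rankOneMap f ν) t ρ = (f ρ / (1 + f (lamHat K (trunc t ν)))) • trunc t ν := by
  set σ := lamHat K (trunc t ν) with hσ
  -- The preimage of `ρ` under `I + Λ̂ω|ₜ`; applying `f` to it gives `f(ρ) / (1 + f(σ))`.
  have e : onePlus (rankOneMap f ν) t (ρ - (f ρ / (1 + f σ)) • σ) = ρ := by
    rw [onePlus_rankOneMap, ← hσ, map_sub, map_smul, smul_eq_mul, sub_add, ← sub_smul]
    have : f ρ / (1 + f σ) - (f ρ - f ρ / (1 + f σ) * f σ) = 0 := by
      field_simp; ring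
    rw [this, zero_smul, sub_zero]
  conv_lhs => rw [← e]
  rw [boundaryRep_apply_onePlus (isUnit_onePlus_rankOneMap h), trunc_rankOneMap, map_sub, map_smul,
    smul_eq_mul]
  congr 1
  field_simp; ring

/-- Ordinary positivity in both directions already gives equality on positive functionals and
positive operators. These span, and the representation determines the map. -/
theorem QSubordinate.antisymm {ω η : BoundaryWeightMap K} (hω : ∀ t, IsUnit (onePlus ω t))
    (hη : ∀ t, IsUnit (onePlus η t)) (h : QSubordinate ω η) (h' : QSubordinate η ω) : ω = η := by
  refine eq_of_boundaryRep_eq hω hη fun t => ?_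
  refine eq_of_eq_on_isPositive fun ρ hρ => ?_
  have e : (boundaryRep ω t ρ).1.toLinearMap = (boundaryRep η t ρ).1.toLinearMap := by
    refine eq_of_eq_on_nonneg fun A hA => ?_
    have h1 := (h t).map_isPositive hρ A hA
    have h2 := (h' t).map_isPositive hρ A hA
    rw [LinearMap.sub_apply, Predual.sub_apply, sub_nonneg] at h1 h2
    exact le_antisymm h1 h2
  exact Predual.ext fun A => LinearMap.congr_fun e A

end BoundaryRep

/-! ### Positive complex numbers, operators and functionals -/

section PositiveFunctionals

variable {H : Type*} [NormedAddCommGroup H] [InnerProductSpace ℂ H]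

theorem ofReal_re_of_nonneg {z : ℂ} (hz : 0 ≤ z) : ((z.re : ℝ) : ℂ) = z :=
  Complex.ext rfl (Complex.nonneg_iff.1 hz).2

theorem re_nonneg_of_nonneg {z : ℂ} (hz : 0 ≤ z) : 0 ≤ z.re := (Complex.nonneg_iff.1 hz).1

theorem one_add_ne_zero_of_nonneg {z : ℂ} (hz : 0 ≤ z) : 1 + z ≠ 0 := by
  intro h
  have h1 := re_nonneg_of_nonneg hz
  have h2 := congrArg Complex.re h
  simp only [Complex.add_re, Complex.one_re, Complex.zero_re] at h2
  linarith

theorem smul_operator_nonneg {c : ℂ} (hc : 0 ≤ c) {A : H →L[ℂ] H} (hA : 0 ≤ A) : 0 ≤ c • A :=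
  (ContinuousLinearMap.nonneg_iff_isPositive _).2
    (((ContinuousLinearMap.nonneg_iff_isPositive _).1 hA).smul_of_nonneg hc)

theorem ofReal_smul_nonneg {c : ℝ} (hc : 0 ≤ c) {A : H →L[ℂ] H} (hA : 0 ≤ A) :
    0 ≤ (c : ℂ) • A :=
  smul_operator_nonneg (by exact_mod_cast hc) hA

theorem Predual.IsPositive.smul {ρ : Predual H} (hρ : ρ.IsPositive) {c : ℂ} (hc : 0 ≤ c) :
    (c • ρ).IsPositive := fun A hA => mul_nonneg hc (hρ A hA)

theorem Predual.IsPositive.add {ρ σ : Predual H} (hρ : ρ.IsPositive) (hσ : σ.IsPositive) :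
    (ρ + σ).IsPositive := fun A hA => add_nonneg (hρ A hA) (hσ A hA)

theorem Predual.IsPositive.re_nonneg {ρ : Predual H} (hρ : ρ.IsPositive) {A : H →L[ℂ] H}
    (hA : 0 ≤ A) : 0 ≤ (ρ.1 A).re := re_nonneg_of_nonneg (hρ A hA)

theorem Predual.IsPositive.ofReal_re {ρ : Predual H} (hρ : ρ.IsPositive) {A : H →L[ℂ] H}
    (hA : 0 ≤ A) : (((ρ.1 A).re : ℝ) : ℂ) = ρ.1 A := ofReal_re_of_nonneg (hρ A hA)

variable [CompleteSpace H]

theorem Predual.IsPositive.mono {ρ : Predual H} (hρ : ρ.IsPositive) {A B : H →L[ℂ] H}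
    (h : A ≤ B) : ρ.1 A ≤ ρ.1 B := by
  rw [← sub_nonneg, ← Predual.map_sub]
  exact hρ _ (sub_nonneg.2 h)

theorem Predual.IsPositive.re_mono {ρ : Predual H} (hρ : ρ.IsPositive) {A B : H →L[ℂ] H}
    (h : A ≤ B) : (ρ.1 A).re ≤ (ρ.1 B).re := (Complex.le_def.1 (hρ.mono h)).1

theorem le_norm_smul_one {A : H →L[ℂ] H} (hA : 0 ≤ A) :
    A ≤ ((‖A‖ : ℝ) : ℂ) • (1 : H →L[ℂ] H) := by
  have := IsSelfAdjoint.le_algebraMap_norm_self (IsSelfAdjoint.of_nonneg hA)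
  rwa [Algebra.algebraMap_eq_smul_one, ← Complex.coe_smul] at this

theorem Predual.IsPositive.norm_le {ρ : Predual H} (hρ : ρ.IsPositive) : ‖ρ‖ ≤ (ρ.1 1).re :=
  ContinuousLinearMap.opNorm_le_bound _ (hρ.re_nonneg zero_le_one)
    fun A => norm_apply_le_of_positive ρ.1.toLinearMap hρ A

theorem Predual.norm_apply_le (ρ : Predual H) (A : H →L[ℂ] H) : ‖ρ.1 A‖ ≤ ‖ρ‖ * ‖A‖ :=
  ContinuousLinearMap.le_opNorm ρ.1 A

end PositiveFunctionals

/-! ### Rank one maps: the `q`-weight property and subordination -/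

section RankOne

variable {K : Type*} [NormedAddCommGroup K] [InnerProductSpace ℂ K] [CompleteSpace K]

theorem trunc_lam_nonneg {D : K →L[ℂ] K} (hD : 0 ≤ D) {ν : boundaryWeights K}
    (hν : IsPositiveWeight ν) (t : Set.Ioi (0 : ℝ)) : 0 ≤ (trunc t ν).1 (lam D) :=
  trunc_isPositive hν t _ (lam_nonneg hD)

theorem isUnit_onePlus_rankOneMap_evalAt {D : K →L[ℂ] K} (hD : 0 ≤ D) {ν : boundaryWeights K}
    (hν : IsPositiveWeight ν) (t : Set.Ioi (0 : ℝ)) :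
    IsUnit (onePlus (rankOneMap (evalAt K D) ν) t) :=
  isUnit_onePlus_rankOneMap (one_add_ne_zero_of_nonneg (trunc_lam_nonneg hD hν t))

theorem boundaryRep_rankOneMap_evalAt {D : K →L[ℂ] K} (hD : 0 ≤ D) {ν : boundaryWeights K}
    (hν : IsPositiveWeight ν) (t : Set.Ioi (0 : ℝ)) (ρ : Predual K) :
    boundaryRep (rankOneMap (evalAt K D) ν) t ρ =
      (ρ.1 D / (1 + (trunc t ν).1 (lam D))) • trunc t ν :=
  boundaryRep_rankOneMap (one_add_ne_zero_of_nonneg (trunc_lam_nonneg hD hν t)) ρ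

/-- The assumed inequality is contractivity of the explicit representation. The bound at `I - Λ`
follows from it as `t → 0+`, since `ν|ₜ(Λ(D)) ≤ ‖D‖ ν|ₜ(Λ)`. -/
theorem isQWeightMap_rankOneMap {D : K →L[ℂ] K} (hD : 0 ≤ D) {ν : boundaryWeights K}
    (hν : IsPositiveWeight ν)
    (h : ∀ t, ‖D‖ * ((trunc t ν).1 1).re ≤ 1 + ((trunc t ν).1 (lam D)).re) :
    IsQWeightMap (rankOneMap (evalAt K D) ν) where
  completelyPositive := rankOneMap_evalAt_completelyPositive hD hν
  bound := fun ρ hρ => by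
    have hB : (0 : HL K →L[ℂ] HL K) ≤ 1 - lam (1 : K →L[ℂ] K) := sub_nonneg.2 lam_one_le_one
    set B : boundaryAlgebra K := ⟨1 - lam 1, one_sub_lam_mem⟩ with hBdef
    have h1 : ‖D‖ * (ν.1 B).re ≤ 1 := by
      have hlim := (Complex.continuous_re.tendsto _).comp (tendsto_trunc_apply ν B)
      refine le_of_tendsto (hlim.const_mul ‖D‖) (Eventually.of_forall fun t => ?_)
      have hpos := trunc_isPositive hν t
      have h2 : ((trunc t ν).1 (lam D)).re ≤ ‖D‖ * ((trunc t ν).1 (lam 1)).re := by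
        have h3 := hpos.re_mono (lam_mono (le_norm_smul_one hD))
        rwa [map_smul, Predual.map_smul, Complex.re_ofReal_mul] at h3
      have h4 : ((trunc t ν).1 (1 - lam 1)).re =
          ((trunc t ν).1 1).re - ((trunc t ν).1 (lam 1)).re := by
        rw [Predual.map_sub, Complex.sub_re]
      change ‖D‖ * ((trunc t ν).1 (1 - lam 1)).re ≤ 1
      rw [h4]
      linarith [h t]
    have h2 : (ρ.1 D).re ≤ ‖D‖ * (ρ.1 1).re := by
      have h3 := hρ.re_mono (le_norm_smul_one hD)
      rwa [Predual.map_smul, Complex.re_ofReal_mul] at h3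
    have h3 : 0 ≤ ν.1 B := hν B hB
    change (ρ.1 D * ν.1 B).re ≤ _
    rw [← hρ.ofReal_re hD, Complex.re_ofReal_mul]
    have h4 := re_nonneg_of_nonneg h3
    have h5 := hρ.re_nonneg (A := 1) zero_le_one
    calc (ρ.1 D).re * (ν.1 B).re ≤ ‖D‖ * (ρ.1 1).re * (ν.1 B).re := by gcongr
      _ = (ρ.1 1).re * (‖D‖ * (ν.1 B).re) := by ring
      _ ≤ (ρ.1 1).re * 1 := by gcongr
      _ = _ := mul_one _
  invertible := isUnit_onePlus_rankOneMap_evalAt hD hν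
  boundaryRep_completelyPositive := fun t => by
    have hd := trunc_lam_nonneg hD hν t
    have e : boundaryRep (rankOneMap (evalAt K D) ν) t =
        (evalAt K D).smulRight ((1 + (trunc t ν).1 (lam D))⁻¹ • trunc t ν) :=
      LinearMap.ext fun ρ => by
        rw [boundaryRep_rankOneMap_evalAt hD hν, div_eq_mul_inv, mul_smul]
        rfl
    rw [e]
    exact isCompletelyPositive_smulRight hD ((trunc_isPositive hν t).smul
      (by rw [← ofReal_re_of_nonneg hd]
          have := re_nonneg_of_nonneg hd
          exact_mod_cast (by positivity : (0 : ℝ) ≤ (1 + ((trunc t ν).1 (lam D)).re)⁻¹)))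
  boundaryRep_contraction := fun t ρ => by
    have hd := trunc_lam_nonneg hD hν t
    have hd' := re_nonneg_of_nonneg hd
    rw [boundaryRep_rankOneMap_evalAt hD hν, norm_smul, norm_div]
    have hn : ‖1 + (trunc t ν).1 (lam D)‖ = 1 + ((trunc t ν).1 (lam D)).re := by
      rw [← ofReal_re_of_nonneg hd]
      norm_cast
      rw [Real.norm_of_nonneg (by positivity)]
    rw [hn, div_mul_eq_mul_div, div_le_iff₀ (by positivity)]
    calc ‖ρ.1 D‖ * ‖trunc t ν‖ ≤ (‖ρ‖ * ‖D‖) * ((trunc t ν).1 1).re := by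
          gcongr
          · exact ρ.norm_apply_le D
          · exact (trunc_isPositive hν t).norm_le
      _ = ‖ρ‖ * (‖D‖ * ((trunc t ν).1 1).re) := by ring
      _ ≤ _ := by gcongr; exact h t

/-- Subordination of rank one maps with the same boundary weight. -/
theorem qSubordinate_of_operator_le {D D' : K →L[ℂ] K} (hD : 0 ≤ D) (hD' : 0 ≤ D')
    {ν : boundaryWeights K} (hν : IsPositiveWeight ν)
    (h : ∀ t, ((1 + ((trunc t ν).1 (lam D)).re : ℝ) : ℂ) • D' ≤
      ((1 + ((trunc t ν).1 (lam D')).re : ℝ) : ℂ) • D) :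
    QSubordinate (rankOneMap (evalAt K D') ν) (rankOneMap (evalAt K D) ν) := by
  intro t
  have hd := re_nonneg_of_nonneg (trunc_lam_nonneg hD hν t)
  have hd' := re_nonneg_of_nonneg (trunc_lam_nonneg hD' hν t)
  set d := ((trunc t ν).1 (lam D)).re with hdd
  set d' := ((trunc t ν).1 (lam D')).re with hdd'
  have e1 : (trunc t ν).1 (lam D) = (d : ℂ) := ((trunc_isPositive hν t).ofReal_re
    (lam_nonneg hD)).symm
  have e2 : (trunc t ν).1 (lam D') = (d' : ℂ) := ((trunc_isPositive hν t).ofReal_re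
    (lam_nonneg hD')).symm
  have n1 : (1 + d : ℂ) ≠ 0 := by exact_mod_cast (by positivity : (1 + d : ℝ) ≠ 0)
  have n2 : (1 + d' : ℂ) ≠ 0 := by exact_mod_cast (by positivity : (1 + d' : ℝ) ≠ 0)
  -- `X = D/(1 + d) - D'/(1 + d')`: the difference of the two representations is `ρ ↦ ρ(X) ν|ₜ`.
  set X : K →L[ℂ] K := (((1 + d) * (1 + d'))⁻¹ : ℝ) • (((1 + d' : ℝ) : ℂ) • D -
    ((1 + d : ℝ) : ℂ) • D') with hX
  have hXpos : 0 ≤ X := smul_nonneg (by positivity) (sub_nonneg.2 (h t))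
  have e : boundaryRep (rankOneMap (evalAt K D) ν) t - boundaryRep (rankOneMap (evalAt K D') ν) t =
      (evalAt K X).smulRight (trunc t ν) := LinearMap.ext fun ρ => by
    rw [LinearMap.sub_apply, boundaryRep_rankOneMap_evalAt hD hν,
      boundaryRep_rankOneMap_evalAt hD' hν, e1, e2, ← sub_smul, LinearMap.smulRight_apply,
      evalAt_apply, hX, ← Complex.coe_smul, Predual.map_smul, Predual.map_sub, Predual.map_smul,
      Predual.map_smul]
    congr 1
    push_cast
    field_simp
  rw [e]
  exact isCompletelyPositive_smulRight hXpos (trunc_isPositive hν t)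

/-- Subordination of rank one maps with the same operator. -/
theorem qSubordinate_of_weight_le {D : K →L[ℂ] K} (hD : 0 ≤ D)
    {ν ν' : boundaryWeights K} (hν : IsPositiveWeight ν) (hν' : IsPositiveWeight ν')
    (h : ∀ t A, 0 ≤ A → ((trunc t ν').1 A).re * (1 + ((trunc t ν).1 (lam D)).re) ≤
      ((trunc t ν).1 A).re * (1 + ((trunc t ν').1 (lam D)).re)) :
    QSubordinate (rankOneMap (evalAt K D) ν') (rankOneMap (evalAt K D) ν) := by
  intro t
  have hd := re_nonneg_of_nonneg (trunc_lam_nonneg hD hν t)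
  have hd' := re_nonneg_of_nonneg (trunc_lam_nonneg hD hν' t)
  have hh := h t
  set d := ((trunc t ν).1 (lam D)).re with hdd
  set d' := ((trunc t ν').1 (lam D)).re with hdd'
  have e1 : (trunc t ν).1 (lam D) = (d : ℂ) := ((trunc_isPositive hν t).ofReal_re
    (lam_nonneg hD)).symm
  have e2 : (trunc t ν').1 (lam D) = (d' : ℂ) := ((trunc_isPositive hν' t).ofReal_re
    (lam_nonneg hD)).symm
  set φ : Predual (HL K) := ((1 + d : ℝ) : ℂ)⁻¹ • trunc t ν - ((1 + d' : ℝ) : ℂ)⁻¹ • trunc t ν'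
    with hφ
  have hφpos : φ.IsPositive := fun A hA => by
    rw [hφ, Predual.sub_apply, Predual.smul_apply, Predual.smul_apply, sub_nonneg,
      ← (trunc_isPositive hν t).ofReal_re hA, ← (trunc_isPositive hν' t).ofReal_re hA]
    have := hh A hA
    norm_cast
    rw [inv_mul_eq_div, inv_mul_eq_div, div_le_div_iff₀ (by positivity) (by positivity)]
    exact this
  have e : boundaryRep (rankOneMap (evalAt K D) ν) t - boundaryRep (rankOneMap (evalAt K D) ν') t =
      (evalAt K D).smulRight φ := LinearMap.ext fun ρ => by
    rw [LinearMap.sub_apply, boundaryRep_rankOneMap_evalAt hD hν,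
      boundaryRep_rankOneMap_evalAt hD hν', e1, e2, LinearMap.smulRight_apply, evalAt_apply, hφ,
      smul_sub, smul_smul, smul_smul, div_eq_mul_inv, div_eq_mul_inv]
    push_cast
    rfl
  rw [e]
  exact isCompletelyPositive_smulRight hD hφpos

theorem lam_ofReal_smul_re (ν : boundaryWeights K) (t : Set.Ioi (0 : ℝ)) (c : ℝ)
    (T : K →L[ℂ] K) :
    ((trunc t ν).1 (lam ((c : ℂ) • T))).re = c * ((trunc t ν).1 (lam T)).re := by
  rw [map_smul, Predual.map_smul, Complex.re_ofReal_mul]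

variable {T : K →L[ℂ] K} {μ : boundaryWeights K}

theorem isQWeightMap_rankOneMap_smul (hT : 0 ≤ T) (hT1 : ‖T‖ = 1) (hμ : IsPositiveWeight μ)
    (hc : ∀ t, ((trunc t μ).1 1).re ≤ 1 + ((trunc t μ).1 (lam T)).re) {c : ℝ} (h0 : 0 ≤ c)
    (h1 : c ≤ 1) : IsQWeightMap (rankOneMap (evalAt K ((c : ℂ) • T)) μ) := by
  refine isQWeightMap_rankOneMap (ofReal_smul_nonneg h0 hT) hμ fun t => ?_
  rw [lam_ofReal_smul_re, norm_smul, hT1, Complex.norm_of_nonneg h0, mul_one]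
  have := hc t
  nlinarith

/-- For `h ≥ 0` the coefficient `c / (1 + c h)` increases with `c ≥ 0`. -/
theorem qSubordinate_rankOneMap_smul (hT : 0 ≤ T) (hμ : IsPositiveWeight μ) {c c' : ℝ}
    (h0 : 0 ≤ c) (h1 : c ≤ c') :
    QSubordinate (rankOneMap (evalAt K ((c : ℂ) • T)) μ)
      (rankOneMap (evalAt K ((c' : ℂ) • T)) μ) := by
  refine qSubordinate_of_operator_le (ofReal_smul_nonneg (h0.trans h1) hT)
    (ofReal_smul_nonneg h0 hT) hμ fun t => ?_
  rw [lam_ofReal_smul_re, lam_ofReal_smul_re, ← sub_nonneg, smul_smul, smul_smul, ← sub_smul,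
    ← Complex.ofReal_mul, ← Complex.ofReal_mul, ← Complex.ofReal_sub]
  refine ofReal_smul_nonneg ?_ hT
  have := re_nonneg_of_nonneg (trunc_lam_nonneg hT hμ t)
  nlinarith

end RankOne

/-! ### `q`-purity in terms of scalar multiples -/

section Purity

variable {K : Type*} [NormedAddCommGroup K] [InnerProductSpace ℂ K] [CompleteSpace K]
variable {T : K →L[ℂ] K} {μ : boundaryWeights K}

/-- Only `c ∈ [0, 1]` matters; the absolute value keeps the denominator `1 + |c| h` nonzero on all
of `ℝ`. -/
theorem continuous_boundaryRep_smul (hT : 0 ≤ T) (hμ : IsPositiveWeight μ) (t : Set.Ioi (0 : ℝ))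
    (ρ : Predual K) (A : HL K →L[ℂ] HL K) :
    Continuous fun c : ℝ =>
      (boundaryRep (rankOneMap (evalAt K (((|c| : ℝ) : ℂ) • T)) μ) t ρ).1 A := by
  have hd := trunc_lam_nonneg hT hμ t
  have e : ∀ c : ℝ, (boundaryRep (rankOneMap (evalAt K (((|c| : ℝ) : ℂ) • T)) μ) t ρ).1 A =
      ((|c| : ℝ) : ℂ) * ρ.1 T / (1 + ((|c| : ℝ) : ℂ) * (trunc t μ).1 (lam T)) *
        (trunc t μ).1 A := fun c => by
    rw [boundaryRep_rankOneMap_evalAt (ofReal_smul_nonneg (abs_nonneg c) hT) hμ,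
      Predual.smul_apply, Predual.map_smul, map_smul, Predual.map_smul]
  simp only [e]
  refine Continuous.mul (Continuous.div (by fun_prop) (by fun_prop) fun c => ?_) continuous_const
  exact one_add_ne_zero_of_nonneg (mul_nonneg (by exact_mod_cast abs_nonneg c) hd)

/-- Subordination is an intersection of closed scalar inequalities, each continuous in `c`. -/
theorem isClosed_setOf_smul_qSubordinate (hT : 0 ≤ T) (hμ : IsPositiveWeight μ)
    (η : BoundaryWeightMap K) :
    IsClosed {c : ℝ | QSubordinate (rankOneMap (evalAt K (((|c| : ℝ) : ℂ) • T)) μ) η} := by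
  simp only [QSubordinate, IsCompletelyPositive, Predual.IsPositiveMatrix, Set.ofPred_forall]
  refine isClosed_iInter fun t => isClosed_iInter fun n => isClosed_iInter fun ρ =>
    isClosed_iInter fun _ => isClosed_iInter fun A => isClosed_iInter fun _ => ?_
  refine isClosed_le continuous_const (continuous_finsetSum _ fun i _ => ?_)
  refine continuous_finsetSum _ fun j _ => ?_
  simp only [LinearMap.sub_apply, Predual.sub_apply]
  exact continuous_const.sub (continuous_boundaryRep_smul hT hμ t _ _)

theorem isClosed_setOf_qSubordinate_smul (hT : 0 ≤ T) (hμ : IsPositiveWeight μ)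
    (η : BoundaryWeightMap K) :
    IsClosed {c : ℝ | QSubordinate η (rankOneMap (evalAt K (((|c| : ℝ) : ℂ) • T)) μ)} := by
  simp only [QSubordinate, IsCompletelyPositive, Predual.IsPositiveMatrix, Set.ofPred_forall]
  refine isClosed_iInter fun t => isClosed_iInter fun n => isClosed_iInter fun ρ =>
    isClosed_iInter fun _ => isClosed_iInter fun A => isClosed_iInter fun _ => ?_
  refine isClosed_le continuous_const (continuous_finsetSum _ fun i _ => ?_)
  refine continuous_finsetSum _ fun j _ => ?_
  simp only [LinearMap.sub_apply, Predual.sub_apply]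
  exact (continuous_boundaryRep_smul hT hμ t _ _).sub continuous_const

/-- A rank one `q`-weight map is `q`-pure exactly if its `q`-subordinates are its multiples. -/
theorem isQPure_iff_subordinates_eq_smul (hT : 0 ≤ T) (hT1 : ‖T‖ = 1) (hμ : IsPositiveWeight μ)
    (hc : ∀ t, ((trunc t μ).1 1).re ≤ 1 + ((trunc t μ).1 (lam T)).re) :
    IsQPure (rankOneMap (evalAt K T) μ) ↔
      ∀ η : BoundaryWeightMap K, IsQWeightMap η → QSubordinate η (rankOneMap (evalAt K T) μ) →
        ∃ c : ℝ, 0 ≤ c ∧ c ≤ 1 ∧ η = rankOneMap (evalAt K ((c : ℂ) • T)) μ := by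
  have hT' : T = ((1 : ℝ) : ℂ) • T := by simp
  constructor
  · intro hp η hη hsub
    have hsub1 : ∀ c : ℝ, 0 ≤ c → c ≤ 1 →
        QSubordinate (rankOneMap (evalAt K ((c : ℂ) • T)) μ) (rankOneMap (evalAt K T) μ) := by
      intro c h0 h1
      have := qSubordinate_rankOneMap_smul hT hμ h0 h1
      rwa [← hT'] at this
    -- Total ordering of the subordinates makes `η` comparable with every multiple of the map.
    have hcov : Set.Icc (0 : ℝ) 1 ⊆
        {c : ℝ | QSubordinate (rankOneMap (evalAt K (((|c| : ℝ) : ℂ) • T)) μ) η} ∪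
        {c : ℝ | QSubordinate η (rankOneMap (evalAt K (((|c| : ℝ) : ℂ) • T)) μ)} := by
      intro c hc'
      have ha : |c| = c := abs_of_nonneg hc'.1
      simp only [Set.mem_union, Set.mem_ofPred_eq, ha]
      exact hp _ _ (isQWeightMap_rankOneMap_smul hT hT1 hμ hc hc'.1 hc'.2) hη
        (hsub1 c hc'.1 hc'.2) hsub
    have hzero : QSubordinate (rankOneMap (evalAt K (((|(0 : ℝ)| : ℝ) : ℂ) • T)) μ) η := by
      intro t
      have e : boundaryRep (rankOneMap (evalAt K (((|(0 : ℝ)| : ℝ) : ℂ) • T)) μ) t = 0 :=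
        LinearMap.ext fun ρ => by
          rw [boundaryRep_rankOneMap_evalAt (ofReal_smul_nonneg (abs_nonneg _) hT) hμ,
            Predual.map_smul, abs_zero, Complex.ofReal_zero, zero_mul, zero_div, zero_smul]
          rfl
      rw [e, sub_zero]
      exact hη.boundaryRep_completelyPositive t
    have hone : QSubordinate η (rankOneMap (evalAt K (((|(1 : ℝ)| : ℝ) : ℂ) • T)) μ) := by
      rw [abs_one, ← hT']
      exact hsub
    -- Two closed sets cover `[0, 1]`, one containing `0` and the other `1`, so they meet; at a
    -- common `c`, antisymmetry identifies `η`.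
    obtain ⟨c, hcI, h1, h2⟩ := isPreconnected_closed_iff.1 (isPreconnected_Icc (a := (0 : ℝ))
      (b := 1)) _ _ (isClosed_setOf_smul_qSubordinate hT hμ η)
      (isClosed_setOf_qSubordinate_smul hT hμ η) hcov
      ⟨0, Set.left_mem_Icc.2 zero_le_one, hzero⟩ ⟨1, Set.right_mem_Icc.2 zero_le_one, hone⟩
    simp only [Set.mem_ofPred_eq, abs_of_nonneg hcI.1] at h1 h2
    exact ⟨c, hcI.1, hcI.2, QSubordinate.antisymm hη.invertible
      (isUnit_onePlus_rankOneMap_evalAt (ofReal_smul_nonneg hcI.1 hT) hμ) h2 h1⟩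
  · intro h η η' hη hη' hs hs'
    obtain ⟨c, h0, -, rfl⟩ := h η hη hs
    obtain ⟨c', h0', -, rfl⟩ := h η' hη' hs'
    rcases le_total c c' with hle | hle
    · exact Or.inl (qSubordinate_rankOneMap_smul hT hμ h0 hle)
    · exact Or.inr (qSubordinate_rankOneMap_smul hT hμ h0' hle)

omit [CompleteSpace K] in
theorem exists_weight_apply_ne_zero (hμ : μ ≠ 0) : ∃ B : boundaryAlgebra K, μ.1 B ≠ 0 := by
  by_contra! h
  exact hμ (Subtype.ext (LinearMap.ext h))

omit [CompleteSpace K] in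
theorem eq_of_smul_weight_eq (hμ : μ ≠ 0) {a b : ℂ} (h : a • μ = b • μ) : a = b := by
  obtain ⟨B, hB⟩ := exists_weight_apply_ne_zero hμ
  have h1 : a * μ.1 B = b * μ.1 B := congrArg (fun w : boundaryWeights K => w.1 B) h
  exact mul_right_cancel₀ hB h1

omit [CompleteSpace K] in
theorem rankOneMap_apply_eq {f g : Predual K →ₗ[ℂ] ℂ} {ν ν' : boundaryWeights K}
    (h : rankOneMap f ν = rankOneMap g ν') (ρ : Predual K) : f ρ • ν = g ρ • ν' := by
  rw [← rankOneMap_apply, h, rankOneMap_apply]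

/-- The inequality that gives subordination also gives contractivity: by norms, `(1 + h) ‖D‖ ≤ 1 +
d`, and `μ|ₜ(I) ≤ 1 + h`. -/
theorem isQWeightMap_of_operator_le (hT : 0 ≤ T) (hT1 : ‖T‖ = 1) (hμ : IsPositiveWeight μ)
    (hc : ∀ t, ((trunc t μ).1 1).re ≤ 1 + ((trunc t μ).1 (lam T)).re) {D : K →L[ℂ] K} (hD : 0 ≤ D)
    (hle : ∀ t, ((1 + ((trunc t μ).1 (lam T)).re : ℝ) : ℂ) • D ≤
      ((1 + ((trunc t μ).1 (lam D)).re : ℝ) : ℂ) • T) :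
    IsQWeightMap (rankOneMap (evalAt K D) μ) := by
  refine isQWeightMap_rankOneMap hD hμ fun t => ?_
  have hh := re_nonneg_of_nonneg (trunc_lam_nonneg hT hμ t)
  have hh' := re_nonneg_of_nonneg (trunc_lam_nonneg hD hμ t)
  have h1 := hc t
  have h2 := hle t
  generalize ((trunc t μ).1 (lam T)).re = h at *
  generalize ((trunc t μ).1 (lam D)).re = d at *
  generalize ((trunc t μ).1 1).re = m at *
  have h3 := CStarAlgebra.norm_le_norm_of_nonneg_of_le
    (ofReal_smul_nonneg (by positivity) hD) h2
  rw [norm_smul, norm_smul, hT1, Complex.norm_of_nonneg (by positivity),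
    Complex.norm_of_nonneg (by positivity), mul_one] at h3
  calc ‖D‖ * m ≤ ‖D‖ * (1 + h) := by gcongr
    _ ≤ _ := by rw [mul_comm]; exact h3

/-- If `ω` is `q`-pure, then positive operators below `T` on which the weight is bounded are
multiples of `T`. -/
theorem eq_smul_of_trunc_lam_le_one (hT : 0 ≤ T) (hT1 : ‖T‖ = 1) (hμ : IsPositiveWeight μ)
    (hμ0 : μ ≠ 0) (hc : ∀ t, ((trunc t μ).1 1).re ≤ 1 + ((trunc t μ).1 (lam T)).re)
    (hp : IsQPure (rankOneMap (evalAt K T) μ)) {X : K →L[ℂ] K} (hX : 0 ≤ X) (hXT : X ≤ T)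
    (hμX : ∀ t, ((trunc t μ).1 (lam X)).re ≤ 1) : ∃ c : ℝ, X = (c : ℂ) • T := by
  -- The factor `1/2` provides the slack: with `x = μ|ₜ(Λ(X))`, one has `(1 + d) T - (1 + h) D = (1
  -- - x)/2 · T + (1 + h)/2 · X ≥ 0`.
  set D : K →L[ℂ] K := (((1 / 2 : ℝ)) : ℂ) • (T - X) with hD
  have hD0 : 0 ≤ D := ofReal_smul_nonneg (by norm_num) (sub_nonneg.2 hXT)
  have hdD : ∀ t, ((trunc t μ).1 (lam D)).re =
      1 / 2 * (((trunc t μ).1 (lam T)).re - ((trunc t μ).1 (lam X)).re) := fun t => by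
    rw [hD, lam_ofReal_smul_re, map_sub, Predual.map_sub, Complex.sub_re]
  have hle : ∀ t, ((1 + ((trunc t μ).1 (lam T)).re : ℝ) : ℂ) • D ≤
      ((1 + ((trunc t μ).1 (lam D)).re : ℝ) : ℂ) • T := by
    intro t
    have hh := re_nonneg_of_nonneg (trunc_lam_nonneg hT hμ t)
    have hx := hμX t
    rw [hdD]
    generalize ((trunc t μ).1 (lam T)).re = h at *
    generalize ((trunc t μ).1 (lam X)).re = x at *
    have e : ((1 + 1 / 2 * (h - x) : ℝ) : ℂ) • T - ((1 + h : ℝ) : ℂ) • D =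
        ((1 / 2 * (1 - x) : ℝ) : ℂ) • T + ((1 / 2 * (1 + h) : ℝ) : ℂ) • X := by
      rw [hD]
      push_cast
      module
    rw [← sub_nonneg, e]
    exact add_nonneg (ofReal_smul_nonneg (by linarith) hT) (ofReal_smul_nonneg (by linarith) hX)
  have hq := isQWeightMap_of_operator_le hT hT1 hμ hc hD0 hle
  obtain ⟨c, -, -, hcD⟩ := (isQPure_iff_subordinates_eq_smul hT hT1 hμ hc).1 hp _ hq
    (qSubordinate_of_operator_le hT hD0 hμ hle)
  have hDT : D = (c : ℂ) • T := by
    refine eq_of_predual_eq fun ρ => ?_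
    exact eq_of_smul_weight_eq hμ0 (rankOneMap_apply_eq hcD ρ)
  refine ⟨1 - 2 * c, ?_⟩
  have : X = T - (2 : ℂ) • D := by
    rw [hD]; push_cast; module
  rw [this, hDT]
  push_cast; module

end Purity

section Forward

variable {K : Type*} [NormedAddCommGroup K] [InnerProductSpace ℂ K] [CompleteSpace K]

/-! ### Values of boundary weights as limits of truncations -/

/-- Monotonicity bounds every truncation by the limit value: a finite value bounds all `t` at once.
-/
theorem trunc_re_antitone {μ : boundaryWeights K} (hμ : IsPositiveWeight μ)
    {A : HL K →L[ℂ] HL K} (hA : 0 ≤ A) (hc : ∀ t : ℝ, cutOp K t * A = A * cutOp K t)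
    {s t : Set.Ioi (0 : ℝ)} (h : s ≤ t) : ((trunc t μ).1 A).re ≤ ((trunc s μ).1 A).re := by
  have h1 := congrArg Complex.re (trunc_sub_trunc h μ A)
  have h2 := (trunc_isPositive hμ s).re_nonneg (sub_cut_nonneg hA (hc t))
  rw [Complex.sub_re] at h1
  linarith

theorem weightValue_eq (μ : boundaryWeights K) (A : HL K →L[ℂ] HL K) :
    weightValue μ A = liminf (fun t : Set.Ioi (0 : ℝ) => (((trunc t μ).1 A).re : EReal))
      (comap Subtype.val (𝓝 0)) := rfl

theorem trunc_re_le_weightValue {μ : boundaryWeights K} (hμ : IsPositiveWeight μ)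
    {A : HL K →L[ℂ] HL K} (hA : 0 ≤ A) (hc : ∀ t : ℝ, cutOp K t * A = A * cutOp K t)
    (t : Set.Ioi (0 : ℝ)) : (((trunc t μ).1 A).re : EReal) ≤ weightValue μ A := by
  rw [weightValue_eq]
  refine le_liminf_of_le (by isBoundedDefault) ?_
  filter_upwards [eventually_val_lt t.2] with s hs
  exact EReal.coe_le_coe_iff.2 (trunc_re_antitone hμ hA hc (le_of_lt hs))

omit [CompleteSpace K] in
theorem cutOp_comm_one_sub_lam (t : ℝ) (T : K →L[ℂ] K) :
    cutOp K t * (1 - lam T) = (1 - lam T) * cutOp K t := by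
  rw [mul_sub, sub_mul, cutOp_comm_lam, mul_one, one_mul]

theorem lam_le_one {T : K →L[ℂ] K} (hT : T ≤ 1) : lam T ≤ 1 :=
  (lam_mono hT).trans lam_one_le_one

theorem exists_bound_of_weightValue_ne_top {μ : boundaryWeights K} (hμ : IsPositiveWeight μ)
    {e : K →L[ℂ] K} (he : 0 ≤ e) (h : weightValue μ (lam e) ≠ ⊤) :
    ∃ M : ℝ, ∀ t, ((trunc t μ).1 (lam e)).re ≤ M := by
  by_contra! hM
  refine h (EReal.eq_top_iff_forall_lt _ |>.2 fun y => ?_)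
  obtain ⟨t, ht⟩ := hM y
  exact (EReal.coe_lt_coe_iff.2 ht).trans_le
    (trunc_re_le_weightValue hμ (lam_nonneg he) (fun t => cutOp_comm_lam t e) t)

theorem weightValue_ne_top_of_eventually_le {μ : boundaryWeights K} {A : HL K →L[ℂ] HL K}
    {M : ℝ} (h : ∀ᶠ t : Set.Ioi (0 : ℝ) in comap Subtype.val (𝓝 0), ((trunc t μ).1 A).re ≤ M) :
    weightValue μ A ≠ ⊤ := by
  rw [weightValue_eq]
  refine ne_top_of_le_ne_top (EReal.coe_ne_top M) (liminf_le_of_le (by isBoundedDefault) ?_)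
  intro b hb
  obtain ⟨t, h1, h2⟩ := (hb.and h).exists
  exact h1.trans (EReal.coe_le_coe_iff.2 h2)

theorem le_one_of_norm_eq_one {T : K →L[ℂ] K} (hT : 0 ≤ T) (hT1 : ‖T‖ = 1) : T ≤ 1 := by
  have := le_norm_smul_one hT
  rwa [hT1, Complex.ofReal_one, one_smul] at this

/-- The normalization `μ(I - Λ(T)) ≤ 1` in the truncated form used in all later estimates. -/
theorem trunc_one_le {T : K →L[ℂ] K} (hT : 0 ≤ T) (hT1 : ‖T‖ = 1) {μ : boundaryWeights K}
    (hμ : IsPositiveWeight μ) (hμT : weightValue μ (1 - lam T) ≤ 1) (t : Set.Ioi (0 : ℝ)) :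
    ((trunc t μ).1 1).re ≤ 1 + ((trunc t μ).1 (lam T)).re := by
  have h1 := (trunc_re_le_weightValue hμ (sub_nonneg.2 (lam_le_one (le_one_of_norm_eq_one hT hT1)))
    (fun t => cutOp_comm_one_sub_lam t T) t).trans hμT
  rw [← EReal.coe_one, EReal.coe_le_coe_iff, Predual.map_sub, Complex.sub_re] at h1
  linarith

/-! ### Comparison of boundary weights -/

/-- If `ν|ₜ` is dominated by `μ|ₜ` up to the factor `(a + ν|ₜ(Λ(P))) / (1 + μ|ₜ(Λ(P)))`, then this
factor increases with `t`, and its infimum `κ` satisfies `ν ≤ κ μ`. -/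
theorem exists_factor {μ ν : boundaryWeights K} (hμ : IsPositiveWeight μ)
    (hν : IsPositiveWeight ν) {P : K →L[ℂ] K} (hP : 0 ≤ P) {a : ℝ} (ha : 0 ≤ a)
    (h : ∀ t A, 0 ≤ A → ((trunc t ν).1 A).re * (1 + ((trunc t μ).1 (lam P)).re) ≤
      (a + ((trunc t ν).1 (lam P)).re) * ((trunc t μ).1 A).re) :
    ∃ κ : ℝ, 0 ≤ κ ∧ (∀ t A, 0 ≤ A → ((trunc t ν).1 A).re ≤ κ * ((trunc t μ).1 A).re) ∧
      ∀ t, κ * (1 + ((trunc t μ).1 (lam P)).re) ≤ a + ((trunc t ν).1 (lam P)).re := by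
  have hm : ∀ t, 0 ≤ ((trunc t μ).1 (lam P)).re := fun t =>
    re_nonneg_of_nonneg (trunc_lam_nonneg hP hμ t)
  have hn : ∀ t, 0 ≤ ((trunc t ν).1 (lam P)).re := fun t =>
    re_nonneg_of_nonneg (trunc_lam_nonneg hP hν t)
  set m : Set.Ioi (0 : ℝ) → ℝ := fun t => ((trunc t μ).1 (lam P)).re with hmdef
  set n : Set.Ioi (0 : ℝ) → ℝ := fun t => ((trunc t ν).1 (lam P)).re with hndef
  have hm' : ∀ t, 0 < 1 + m t := fun t => add_pos_of_pos_of_nonneg one_pos (hm t)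
  set k : Set.Ioi (0 : ℝ) → ℝ := fun t => (a + n t) / (1 + m t) with hk
  have hk0 : ∀ t, 0 ≤ k t := fun t => div_nonneg (add_nonneg ha (hn t)) (hm' t).le
  have hkm : ∀ t, k t * (1 + m t) = a + n t := fun t => div_mul_cancel₀ _ (hm' t).ne'
  have hle : ∀ t A, 0 ≤ A → ((trunc t ν).1 A).re ≤ k t * ((trunc t μ).1 A).re := fun t A hA => by
    have h1 : ((trunc t ν).1 A).re * (1 + m t) ≤ (a + n t) * ((trunc t μ).1 A).re := h t A hA
    rw [hk, div_mul_eq_mul_div, le_div_iff₀ (hm' t)]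
    exact h1
  -- Testing with `Λ(P) - E(t, ∞) Λ(P) E(t, ∞) ≥ 0` gives `n s - n t ≤ k s (m s - m t)`. Subtracting
  -- this from `a + n s = k s (1 + m s)` yields `k s (1 + m t) ≤ a + n t`.
  have hmono : ∀ s t, s ≤ t → k s ≤ k t := fun s t hst => by
    have h1 := hle s _ (sub_cut_nonneg (lam_nonneg hP) (cutOp_comm_lam (t : ℝ) P))
    rw [← trunc_sub_trunc hst, ← trunc_sub_trunc hst, Complex.sub_re, Complex.sub_re] at h1
    have h2 : n s - n t ≤ k s * (m s - m t) := h1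
    have h3 := hkm s
    change k s ≤ (a + n t) / (1 + m t)
    rw [le_div_iff₀ (hm' t)]
    linarith
  -- The factor at one time serves at all times: for `s ≤ t` by restricting the bound at `s`, for `t
  -- ≤ s` by monotonicity of `k`.
  have hall : ∀ s t A, 0 ≤ A → ((trunc t ν).1 A).re ≤ k s * ((trunc t μ).1 A).re := by
    intro s t A hA
    have hpos := (trunc_isPositive hμ t).re_nonneg hA
    rcases le_total s t with hst | hts
    · rw [trunc_apply_of_le hst ν, trunc_apply_of_le hst μ]
      exact hle s _ (sandwich_nonneg (isSelfAdjoint_cutOp _) hA)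
    · exact (hle t A hA).trans (mul_le_mul_of_nonneg_right (hmono t s hts) hpos)
  have hbdd : BddBelow (Set.range k) := ⟨0, by rintro _ ⟨t, rfl⟩; exact hk0 t⟩
  have : Nonempty (Set.Ioi (0 : ℝ)) := ⟨⟨1, Set.mem_Ioi.2 one_pos⟩⟩
  refine ⟨⨅ t, k t, le_ciInf hk0, fun t A hA => ?_, fun t => ?_⟩
  · have hpos := (trunc_isPositive hμ t).re_nonneg hA
    rw [Real.iInf_mul_of_nonneg hpos]
    exact le_ciInf fun s => hall s t A hA
  · calc (⨅ t, k t) * (1 + m t) ≤ k t * (1 + m t) :=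
          mul_le_mul_of_nonneg_right (ciInf_le hbdd t) (hm' t).le
      _ = _ := hkm t

theorem weightQDominates_iff {μ ν : boundaryWeights K} (hμ : IsPositiveWeight μ)
    (hν : IsPositiveWeight ν) :
    WeightQDominates μ ν ↔ ∀ t A, 0 ≤ A →
      ((trunc t ν).1 A).re * (1 + ((trunc t μ).1 (lam 1)).re) ≤
        (1 + ((trunc t ν).1 (lam 1)).re) * ((trunc t μ).1 A).re := by
  refine forall_congr' fun t => forall_congr' fun A => imp_congr_right fun hA => ?_
  have h1 := re_nonneg_of_nonneg (trunc_lam_nonneg (D := (1 : K →L[ℂ] K)) zero_le_one hμ t)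
  have h2 := re_nonneg_of_nonneg (trunc_lam_nonneg (D := (1 : K →L[ℂ] K)) zero_le_one hν t)
  rw [truncate_eq_trunc, truncate_eq_trunc, div_le_div_iff₀ (by positivity) (by positivity),
    mul_comm (((trunc t μ).1 A).re)]

omit [CompleteSpace K] in
theorem isPositiveWeight_zero : IsPositiveWeight (0 : boundaryWeights K) := fun _ _ => le_rfl

omit [CompleteSpace K] in
theorem IsPositiveWeight.smul {μ : boundaryWeights K} (hμ : IsPositiveWeight μ) {c : ℝ}
    (hc : 0 ≤ c) : IsPositiveWeight ((c : ℂ) • μ) := fun A hA =>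
  mul_nonneg (by exact_mod_cast hc) (hμ A hA)

theorem trunc_ofReal_smul_re (t : Set.Ioi (0 : ℝ)) (c : ℝ) (μ : boundaryWeights K)
    (A : HL K →L[ℂ] HL K) : ((trunc t ((c : ℂ) • μ)).1 A).re = c * ((trunc t μ).1 A).re := by
  rw [trunc_smul, Predual.smul_apply, Complex.re_ofReal_mul]

theorem weightQDominates_zero {η : boundaryWeights K} (hη : IsPositiveWeight η) :
    WeightQDominates η 0 := by
  rw [weightQDominates_iff hη isPositiveWeight_zero]
  intro t A hA
  have h1 := (trunc_isPositive hη t).re_nonneg hA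
  rw [trunc_zero, Predual.zero_apply, Predual.zero_apply]
  simpa using h1

theorem weightQDominates_smul {μ : boundaryWeights K} (hμ : IsPositiveWeight μ) {c : ℝ}
    (h0 : 0 ≤ c) (h1 : c ≤ 1) : WeightQDominates μ ((c : ℂ) • μ) := by
  rw [weightQDominates_iff hμ (hμ.smul h0)]
  intro t A hA
  have h2 := (trunc_isPositive hμ t).re_nonneg hA
  rw [trunc_ofReal_smul_re, trunc_ofReal_smul_re]
  nlinarith

/-- A positive weight is `q`-pure if every positive weight it dominates is a multiple of it. -/
theorem isQPureWeight_iff {μ : boundaryWeights K} (hμ : IsPositiveWeight μ) :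
    IsQPureWeight μ ↔ ∀ η : boundaryWeights K, IsPositiveWeight η → WeightQDominates μ η →
      ∃ c : ℝ, 0 ≤ c ∧ c ≤ 1 ∧ η = (c : ℂ) • μ := by
  constructor
  · intro h η hη hd
    exact (h η hη).1 ⟨hd, weightQDominates_zero hη⟩
  · refine fun h η hη => ⟨fun hd => h η hη hd.1, ?_⟩
    rintro ⟨c, h0, h1, rfl⟩
    exact ⟨weightQDominates_smul hμ h0 h1, weightQDominates_zero hη⟩

/-! ### Necessity of the three conditions -/

variable {T : K →L[ℂ] K} {μ : boundaryWeights K}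

omit [CompleteSpace K] in
theorem weight_eq_smul_of_smul_eq {ν : boundaryWeights K} {a c : ℂ} (ha : a ≠ 0)
    (h : a • ν = (a * c) • μ) : ν = c • μ := by
  refine Subtype.ext (LinearMap.ext fun B => mul_left_cancel₀ ha ?_)
  have h1 : a * ν.1 B = a * c * μ.1 B := congrArg (fun w : boundaryWeights K => w.1 B) h
  exact h1.trans (mul_assoc _ _ _)

/-- The order on weights is normalized by `Λ(I)`, subordination by `Λ(T)`. Subtracting `η|ₜ ≤ κ μ|ₜ`
at `Λ(I - T)` passes from one to the other. -/
theorem exists_factor_of_weightQDominates (hT1 : T ≤ 1) (hμ : IsPositiveWeight μ)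
    {η : boundaryWeights K} (hη : IsPositiveWeight η) (hd : WeightQDominates μ η) :
    ∃ κ : ℝ, 0 ≤ κ ∧ (∀ t A, 0 ≤ A → ((trunc t η).1 A).re ≤ κ * ((trunc t μ).1 A).re) ∧
      ∀ t, κ * (1 + ((trunc t μ).1 (lam T)).re) ≤ 1 + ((trunc t η).1 (lam T)).re := by
  obtain ⟨κ, hκ0, hκ, hκ1⟩ := exists_factor hμ hη (P := 1) zero_le_one zero_le_one
    ((weightQDominates_iff hμ hη).1 hd)
  refine ⟨κ, hκ0, hκ, fun t => ?_⟩
  have h1 := hκ t _ (lam_nonneg (sub_nonneg.2 hT1))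
  rw [map_sub, Predual.map_sub, Predual.map_sub, Complex.sub_re, Complex.sub_re] at h1
  have h2 := hκ1 t
  linarith

theorem qSubordinate_of_weightQDominates (hT : 0 ≤ T) (hT1 : ‖T‖ = 1) (hμ : IsPositiveWeight μ)
    (hc : ∀ t, ((trunc t μ).1 1).re ≤ 1 + ((trunc t μ).1 (lam T)).re)
    {η : boundaryWeights K} (hη : IsPositiveWeight η) (hd : WeightQDominates μ η) :
    IsQWeightMap (rankOneMap (evalAt K T) η) ∧
      QSubordinate (rankOneMap (evalAt K T) η) (rankOneMap (evalAt K T) μ) := by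
  obtain ⟨κ, hκ0, hκ, hκT⟩ :=
    exists_factor_of_weightQDominates (le_one_of_norm_eq_one hT hT1) hμ hη hd
  refine ⟨isQWeightMap_rankOneMap hT hη fun t => ?_,
    qSubordinate_of_weight_le hT hμ hη fun t A hA => ?_⟩
  · rw [hT1, one_mul]
    exact (hκ t 1 zero_le_one).trans ((mul_le_mul_of_nonneg_left (hc t) hκ0).trans (hκT t))
  · have h1 := (trunc_isPositive hμ t).re_nonneg hA
    have h2 := re_nonneg_of_nonneg (trunc_lam_nonneg hT hμ t)
    have h3 := hκ t A hA
    have h4 := hκT t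
    generalize ((trunc t μ).1 (lam T)).re = h at *
    generalize ((trunc t μ).1 A).re = m at *
    calc _ ≤ κ * m * (1 + h) := mul_le_mul_of_nonneg_right h3 (by positivity)
      _ = m * (κ * (1 + h)) := by ring
      _ ≤ _ := mul_le_mul_of_nonneg_left h4 h1

theorem isQPureWeight_of_isQPure (hT : 0 ≤ T) (hT1 : ‖T‖ = 1) (hμ : IsPositiveWeight μ)
    (hc : ∀ t, ((trunc t μ).1 1).re ≤ 1 + ((trunc t μ).1 (lam T)).re)
    (hp : IsQPure (rankOneMap (evalAt K T) μ)) : IsQPureWeight μ := by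
  rw [isQPureWeight_iff hμ]
  intro η hη hd
  obtain ⟨hq, hs⟩ := qSubordinate_of_weightQDominates hT hT1 hμ hc hη hd
  obtain ⟨c, h0, h1, hcη⟩ := (isQPure_iff_subordinates_eq_smul hT hT1 hμ hc).1 hp _ hq hs
  refine ⟨c, h0, h1, ?_⟩
  obtain ⟨ρ, hρ⟩ : ∃ ρ : Predual K, ρ.1 T ≠ 0 := by
    by_contra! h
    have : T = 0 := eq_of_predual_eq fun ρ => (h ρ).trans (Predual.map_zero ρ).symm
    rw [this, norm_zero] at hT1
    exact zero_ne_one hT1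
  have e : evalAt K ((c : ℂ) • T) ρ = ρ.1 T * c := by
    rw [evalAt_apply, Predual.map_smul, mul_comm]
  exact weight_eq_smul_of_smul_eq hρ
    ((rankOneMap_apply_eq hcη ρ).trans (congrArg (fun z : ℂ => z • μ) e))

/-- Since `T - T² ≤ I - T`, the weight is at most `1` on `Λ(T - T²)`. Purity makes `T²` a real
multiple of `T`, and `‖T²‖ = ‖T‖² = 1` determines the multiple up to sign. -/
theorem isStarProjection_of_isQPure (hT : 0 ≤ T) (hT1 : ‖T‖ = 1) (hμ : IsPositiveWeight μ)
    (hμ0 : μ ≠ 0) (hc : ∀ t, ((trunc t μ).1 1).re ≤ 1 + ((trunc t μ).1 (lam T)).re)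
    (hp : IsQPure (rankOneMap (evalAt K T) μ)) : IsStarProjection T := by
  have hT1' := le_one_of_norm_eq_one hT hT1
  have hsa : IsSelfAdjoint T := IsSelfAdjoint.of_nonneg hT
  have hsa' : IsSelfAdjoint (1 - T) := (IsSelfAdjoint.one _).sub hsa
  have h0 : 0 ≤ 1 - T := sub_nonneg.2 hT1'
  have hX : 0 ≤ T - T * T := by
    have e : T - T * T = T * (1 - T) * T + (1 - T) * T * (1 - T) := by noncomm_ring
    rw [e]
    exact add_nonneg (sandwich_nonneg hsa h0) (sandwich_nonneg hsa' hT)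
  have hTT : 0 ≤ T * T := by simpa using sandwich_nonneg (A := 1) hsa zero_le_one
  have hX1 : T - T * T ≤ 1 - T := by
    rw [← sub_nonneg]
    have e : 1 - T - (T - T * T) = (1 - T) * 1 * (1 - T) := by noncomm_ring
    rw [e]
    exact sandwich_nonneg hsa' zero_le_one
  have hbound : ∀ t, ((trunc t μ).1 (lam (T - T * T))).re ≤ 1 := fun t => by
    have hpos := trunc_isPositive hμ t
    have h1 := hpos.re_mono (lam_mono hX1)
    have h2 := hpos.re_mono (lam_one_le_one (K := K))
    rw [map_sub lam 1 T, Predual.map_sub, Complex.sub_re] at h1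
    linarith [hc t]
  obtain ⟨c, hcX⟩ := eq_smul_of_trunc_lam_le_one hT hT1 hμ hμ0 hc hp hX
    (sub_le_self T hTT) hbound
  have e : T * T = ((1 - c : ℝ) : ℂ) • T := by
    rw [← sub_sub_cancel T (T * T), hcX]
    push_cast; module
  have hn : ‖T * T‖ = 1 := by
    have := CStarRing.norm_star_mul_self (x := T)
    rw [hsa.star_eq, hT1, mul_one] at this
    exact this
  have hc1 : |1 - c| = 1 := by
    rw [e, norm_smul, hT1, mul_one, Complex.norm_real] at hn
    exact hn
  refine ⟨?_, hsa⟩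
  rcases (abs_eq zero_le_one).1 hc1 with h1 | h1
  · rw [IsIdempotentElem, e, h1, Complex.ofReal_one, one_smul]
  -- `T² = -T` would be both nonnegative and nonpositive.
  · exfalso
    have h2 : T * T = -T := by rw [e, h1]; push_cast; module
    have h3 : T * T = 0 := le_antisymm (by rw [h2]; exact neg_nonpos.2 hT) hTT
    rw [h3, norm_zero] at hn
    exact zero_ne_one hn

theorem weightValue_eq_top_of_isQPure (hT : 0 ≤ T) (hT1 : ‖T‖ = 1) (hμ : IsPositiveWeight μ)
    (hμ0 : μ ≠ 0) (hc : ∀ t, ((trunc t μ).1 1).re ≤ 1 + ((trunc t μ).1 (lam T)).re)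
    (hp : IsQPure (rankOneMap (evalAt K T) μ)) (hrank : 1 < LinearMap.rank (T : K →ₗ[ℂ] K))
    {e : K →L[ℂ] K} (he : IsStarProjection e) (he1 : LinearMap.rank (e : K →ₗ[ℂ] K) = 1)
    (heT : e ≤ T) : weightValue μ (lam e) = ⊤ := by
  by_contra hne
  have he0 : 0 ≤ e := he.nonneg
  obtain ⟨M, hM⟩ := exists_bound_of_weightValue_ne_top hμ he0 hne
  -- Small enough for both `δ e ≤ T` and `μ|ₜ(Λ(δ e)) ≤ 1`.
  set δ : ℝ := (max 1 M)⁻¹ with hδ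
  have hmax : 0 < max 1 M := lt_max_of_lt_left one_pos
  have hδ0 : 0 < δ := inv_pos.2 hmax
  have hδ1 : δ ≤ 1 := inv_le_one_of_one_le₀ (le_max_left _ _)
  have hδe : (δ : ℂ) • e ≤ T := by
    refine le_trans ?_ heT
    have e1 : e - (δ : ℂ) • e = ((1 - δ : ℝ) : ℂ) • e := by push_cast; module
    rw [← sub_nonneg, e1]
    exact ofReal_smul_nonneg (by linarith) he0
  obtain ⟨c, hcX⟩ := eq_smul_of_trunc_lam_le_one hT hT1 hμ hμ0 hc hp
    (ofReal_smul_nonneg hδ0.le he0) hδe fun t => by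
      rw [lam_ofReal_smul_re]
      calc δ * _ ≤ δ * max 1 M :=
            mul_le_mul_of_nonneg_left ((hM t).trans (le_max_right _ _)) hδ0.le
        _ = 1 := inv_mul_cancel₀ hmax.ne'
  have hδc : (δ : ℂ) ≠ 0 := by exact_mod_cast hδ0.ne'
  have hc0 : (c : ℂ) ≠ 0 := by
    intro h
    rw [h, zero_smul, smul_eq_zero_iff_right hδc] at hcX
    rw [hcX] at he1
    simp at he1
  have hTe : T = ((c : ℂ)⁻¹ * δ) • e := by
    rw [mul_smul, hcX, smul_smul, inv_mul_cancel₀ hc0, one_smul]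
  have hle : LinearMap.rank (T : K →ₗ[ℂ] K) ≤ LinearMap.rank (e : K →ₗ[ℂ] K) := by
    rw [hTe]
    have e1 : ((((c : ℂ)⁻¹ * δ) • e : K →L[ℂ] K) : K →ₗ[ℂ] K) =
        (((c : ℂ)⁻¹ * δ) • (LinearMap.id : K →ₗ[ℂ] K)) ∘ₗ (e : K →ₗ[ℂ] K) := by
      ext x; simp
    rw [e1]
    exact LinearMap.rank_comp_le_right _ _
  rw [he1] at hle
  exact absurd hrank (not_lt.2 hle)

end Forward

/-! ### Operators below a projection -/

section Operators

variable {K : Type*} [NormedAddCommGroup K] [InnerProductSpace ℂ K] [CompleteSpace K]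

theorem exists_star_mul_self {X : K →L[ℂ] K} (hX : 0 ≤ X) : ∃ S : K →L[ℂ] K, X = star S * S :=
  CStarAlgebra.nonneg_iff_eq_star_mul_self.mp hX

/-- The corner `(1 - T) D (1 - T)` lies between `0` and `(1 - T) T (1 - T) = 0`. Writing `D = S* S`,
this says `S (1 - T) = 0`. -/
theorem mul_eq_self_of_le_isStarProjection {T D : K →L[ℂ] K} (hT : IsStarProjection T)
    (hD : 0 ≤ D) (hDT : D ≤ T) : D * T = D ∧ T * D = D := by
  have hsa : IsSelfAdjoint T := hT.isSelfAdjoint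
  have hsa' : IsSelfAdjoint (1 - T) := (IsSelfAdjoint.one _).sub hsa
  have hTT : T * T = T := hT.isIdempotentElem
  have h1 : (1 - T) * D * (1 - T) ≤ 0 := by
    have h2 := sandwich_nonneg hsa' (sub_nonneg.2 hDT)
    have e : (1 - T) * (T - D) * (1 - T) = (1 - T) * T * (1 - T) - (1 - T) * D * (1 - T) := by
      noncomm_ring
    have e' : (1 - T) * T = 0 := by rw [sub_mul, one_mul, hTT, sub_self]
    rw [e, e', zero_mul, zero_sub] at h2
    exact neg_nonneg.1 h2
  have h2 : (1 - T) * D * (1 - T) = 0 := le_antisymm h1 (sandwich_nonneg hsa' hD)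
  obtain ⟨S, hS⟩ := exists_star_mul_self hD
  have h3 : star (S * (1 - T)) * (S * (1 - T)) = 0 := by
    rw [star_mul, hsa'.star_eq, ← h2, hS]
    simp only [mul_assoc]
  have h4 : S * (1 - T) = 0 := CStarRing.star_mul_self_eq_zero_iff _ |>.1 h3
  have h5 : D * T = D := by
    have : D * (1 - T) = 0 := by rw [hS, mul_assoc, h4, mul_zero]
    rw [mul_sub, mul_one, sub_eq_zero] at this
    exact this.symm
  refine ⟨h5, ?_⟩
  have h6 := congrArg star h5
  rwa [star_mul, hsa.star_eq, (IsSelfAdjoint.of_nonneg hD).star_eq] at h6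

/-- Compress `D ≤ ‖D‖ I` by `T`, which leaves `D` unchanged. -/
theorem le_norm_smul_of_le_isStarProjection {T D : K →L[ℂ] K} (hT : IsStarProjection T)
    (hD : 0 ≤ D) (hDT : D ≤ T) : D ≤ ((‖D‖ : ℝ) : ℂ) • T := by
  obtain ⟨h1, h2⟩ := mul_eq_self_of_le_isStarProjection hT hD hDT
  have h3 := sandwich_nonneg hT.isSelfAdjoint (sub_nonneg.2 (le_norm_smul_one hD))
  have e : T * (((‖D‖ : ℝ) : ℂ) • (1 : K →L[ℂ] K) - D) * T = ((‖D‖ : ℝ) : ℂ) • T - D := by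
    rw [mul_sub, sub_mul, h2, h1, mul_smul_comm, mul_one, smul_mul_assoc,
      hT.isIdempotentElem.eq]
  rw [e] at h3
  exact sub_nonneg.1 h3

theorem norm_inner_apply_sq_le {X : K →L[ℂ] K} (hX : 0 ≤ X) (u x : K) :
    ‖⟪X u, x⟫_ℂ‖ ^ 2 ≤ (⟪u, X u⟫_ℂ).re * (⟪x, X x⟫_ℂ).re := by
  obtain ⟨S, hS⟩ := exists_star_mul_self hX
  have e : ∀ a b, ⟪a, X b⟫_ℂ = ⟪S a, S b⟫_ℂ := fun a b => by
    rw [hS, mul_apply_eq_comp, ContinuousLinearMap.star_eq_adjoint,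
      ContinuousLinearMap.adjoint_inner_right]
  have e' : ⟪X u, x⟫_ℂ = ⟪S u, S x⟫_ℂ := by
    rw [← inner_conj_symm, e, inner_conj_symm]
  have e1 : ∀ a, (⟪a, X a⟫_ℂ).re = ‖S a‖ ^ 2 := fun a => by
    rw [e, ← inner_self_eq_norm_sq (𝕜 := ℂ)]; rfl
  rw [e', e1, e1, ← mul_pow]
  gcongr
  exact norm_inner_le_norm _ _

open InnerProductSpace in
/-- A nonzero positive operator living on the range of a projection `T` dominates a multiple of
a rank one projection below `T`. -/
theorem exists_rankOne_projection_le {T X : K →L[ℂ] K} (hT : IsStarProjection T) (hX : 0 ≤ X)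
    (hTX : T * X = X) (hX0 : X ≠ 0) :
    ∃ (e : K →L[ℂ] K) (k : ℝ), IsStarProjection e ∧ LinearMap.rank (e : K →ₗ[ℂ] K) = 1 ∧ e ≤ T ∧
      0 ≤ k ∧ e ≤ (k : ℂ) • X := by
  obtain ⟨u, hu⟩ : ∃ u, X u ≠ 0 := by
    by_contra! h
    exact hX0 (ContinuousLinearMap.ext h)
  have hn : 0 < ‖X u‖ := norm_pos_iff.2 hu
  -- A unit vector in the range of `X`, hence fixed by `T`; `e` projects onto its span.
  set w : K := ((‖X u‖⁻¹ : ℝ) : ℂ) • X u with hw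
  have hw1 : ‖w‖ = 1 := by
    rw [hw, norm_smul, Complex.norm_of_nonneg (by positivity), inv_mul_cancel₀ hn.ne']
  have hTw : T w = w := by
    rw [hw, map_smul, ← mul_apply_eq_comp, hTX]
  set e : K →L[ℂ] K := rankOne ℂ w w with he
  have hepos : 0 ≤ e := (ContinuousLinearMap.nonneg_iff_isPositive _).2 (isPositive_rankOne_self w)
  have hesa : IsSelfAdjoint e := IsSelfAdjoint.of_nonneg hepos
  have hee : e * e = e := isIdempotentElem_rankOne_self hw1
  have hTe : T * e = e := by
    ext x
    rw [mul_apply_eq_comp, he, rankOne_apply, map_smul, hTw]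
  have heT : e * T = e := by
    have := congrArg star hTe
    rwa [star_mul, hT.isSelfAdjoint.star_eq, hesa.star_eq] at this
  have hw0 : w ≠ 0 := by
    intro h
    rw [h, norm_zero] at hw1
    exact zero_ne_one hw1
  -- The constant comes from Cauchy–Schwarz for the form of `X`: `|⟪X u, x⟫|² ≤ ⟪u, X u⟫ ⟪x, X x⟫`.
  refine ⟨e, (⟪u, X u⟫_ℂ).re * (‖X u‖⁻¹) ^ 2, ⟨hee, hesa⟩, ?_, ?_, ?_, ?_⟩
  · have hr : LinearMap.range (e : K →ₗ[ℂ] K) = Submodule.span ℂ {w} := by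
      refine le_antisymm ?_ ?_
      · rintro _ ⟨x, rfl⟩
        exact Submodule.mem_span_singleton.2 ⟨⟪w, x⟫_ℂ, rfl⟩
      · rw [Submodule.span_singleton_le_iff_mem]
        refine ⟨w, ?_⟩
        change ⟪w, w⟫_ℂ • w = w
        rw [inner_self_eq_norm_sq_to_K, hw1]
        simp
    rw [LinearMap.rank, hr]
    exact Module.rank_eq_one_iff_finrank_eq_one.2 (finrank_span_singleton hw0)
  · rw [← sub_nonneg]
    have e1 : T - e = (1 - e) * T * (1 - e) := by
      rw [sub_mul, one_mul, heT, mul_sub, mul_one, sub_mul, hTe, hee, sub_self, sub_zero]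
    rw [e1]
    exact sandwich_nonneg ((IsSelfAdjoint.one _).sub hesa) hT.nonneg
  · exact mul_nonneg (re_nonneg_of_nonneg ((nonneg_iff_inner X).1 hX u)) (by positivity)
  · rw [← sub_nonneg, nonneg_iff_inner]
    intro x
    have h1 : ⟪x, e x⟫_ℂ = ((‖⟪w, x⟫_ℂ‖ ^ 2 : ℝ) : ℂ) := by
      rw [he, rankOne_apply, inner_smul_right, ← inner_conj_symm x w, RCLike.mul_conj]
      norm_cast
    have h2 : ‖⟪w, x⟫_ℂ‖ ^ 2 = (‖X u‖⁻¹) ^ 2 * ‖⟪X u, x⟫_ℂ‖ ^ 2 := by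
      rw [hw, inner_smul_left, norm_mul, mul_pow, RCLike.norm_conj,
        Complex.norm_of_nonneg (by positivity)]
    have h3 := ofReal_re_of_nonneg ((nonneg_iff_inner X).1 hX x)
    have h4 := norm_inner_apply_sq_le hX u x
    rw [sub_apply, smul_apply, inner_sub_right, inner_smul_right, h1, ← h3, h2,
      ← Complex.ofReal_mul, ← Complex.ofReal_sub]
    have h5 : 0 ≤ (⟪u, X u⟫_ℂ).re * ‖X u‖⁻¹ ^ 2 * (⟪x, X x⟫_ℂ).re -
        ‖X u‖⁻¹ ^ 2 * ‖⟪X u, x⟫_ℂ‖ ^ 2 := by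
      have := mul_le_mul_of_nonneg_left h4 (by positivity : 0 ≤ ‖X u‖⁻¹ ^ 2)
      linarith
    exact_mod_cast h5

theorem exists_eq_smul_of_rank_le_one {T D : K →L[ℂ] K} (hT : IsStarProjection T) (hT0 : T ≠ 0)
    (hrank : LinearMap.rank (T : K →ₗ[ℂ] K) ≤ 1) (hD : 0 ≤ D) (hDT : D ≤ T) :
    ∃ c : ℝ, 0 ≤ c ∧ c ≤ 1 ∧ D = (c : ℂ) • T := by
  obtain ⟨h1, h2⟩ := mul_eq_self_of_le_isStarProjection hT hD hDT
  obtain ⟨v, hv, hspan⟩ := (rank_submodule_le_one_iff _).1 hrank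
  have hmem : ∀ x, ∃ a : ℂ, a • v = T x := fun x =>
    Submodule.mem_span_singleton.1 (hspan ⟨x, rfl⟩)
  have hTv : T v = v := by
    obtain ⟨y, rfl⟩ := hv
    change T (T y) = T y
    rw [← mul_apply_eq_comp, hT.isIdempotentElem.eq]
  have hv0 : v ≠ 0 := by
    rintro rfl
    refine hT0 (ContinuousLinearMap.ext fun x => ?_)
    obtain ⟨a, ha⟩ := hmem x
    rw [← ha, smul_zero]
    rfl
  obtain ⟨l, hl⟩ := hmem (D v)
  rw [← mul_apply_eq_comp, h2] at hl
  have hDl : D = l • T := by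
    ext x
    obtain ⟨a, ha⟩ := hmem x
    rw [smul_apply, ← ha, smul_comm, hl, ← map_smul, ha, ← mul_apply_eq_comp, h1]
  have hvv : ⟪v, v⟫_ℂ = ((‖v‖ ^ 2 : ℝ) : ℂ) := by
    rw [inner_self_eq_norm_sq_to_K]
    norm_cast
  have hcancel : ∀ z : ℂ, 0 ≤ z * ⟪v, v⟫_ℂ → 0 ≤ z := fun z hz => by
    have hpos : 0 < ‖v‖ ^ 2 := pow_pos (norm_pos_iff.2 hv0) 2
    rw [hvv, Complex.nonneg_iff, Complex.re_mul_ofReal, Complex.im_mul_ofReal] at hz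
    exact Complex.nonneg_iff.2 ⟨nonneg_of_mul_nonneg_left hz.1 hpos,
      ((mul_eq_zero.1 hz.2.symm).resolve_right hpos.ne').symm⟩
  have hl0 : 0 ≤ l := by
    have := (nonneg_iff_inner D).1 hD v
    rw [← hl, inner_smul_right] at this
    exact hcancel _ this
  have hl1 : l ≤ 1 := by
    have := (nonneg_iff_inner _).1 (sub_nonneg.2 hDT) v
    rw [sub_apply, hTv, ← hl, inner_sub_right, inner_smul_right, ← one_sub_mul] at this
    exact sub_nonneg.1 (hcancel _ this)
  refine ⟨l.re, re_nonneg_of_nonneg hl0, (Complex.le_def.1 hl1).1, ?_⟩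
  rw [ofReal_re_of_nonneg hl0, hDl]

end Operators

/-! ### Subordinates of a rank one map with `q`-pure boundary weight -/

section Backward

variable {K : Type*} [NormedAddCommGroup K] [InnerProductSpace ℂ K]

theorem IsCompletelyPositiveWeightMap.map_isPositive {η : BoundaryWeightMap K}
    (hη : IsCompletelyPositiveWeightMap η) {ρ : Predual K} (hρ : ρ.IsPositive) :
    IsPositiveWeight (η ρ) := fun A hA => by
  simpa using hη 1 _ (Predual.isPositiveMatrix_const hρ) (fun _ _ => A) (isPositiveMatrix_const hA)

variable [CompleteSpace K] {T : K →L[ℂ] K} {μ : boundaryWeights K} {η : BoundaryWeightMap K}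

theorem re_mul_le_of_le_div {p n a h m : ℂ} (hp : 0 ≤ p) (hn : 0 ≤ n) (ha : 0 ≤ a) (hh : 0 ≤ h)
    (hm : 0 ≤ m) (hle : p ≤ (a + n) / (1 + h) * m) :
    p.re * (1 + h.re) ≤ (a.re + n.re) * m.re := by
  have h2 := re_nonneg_of_nonneg hh
  rw [← ofReal_re_of_nonneg hp, ← ofReal_re_of_nonneg hn, ← ofReal_re_of_nonneg ha,
    ← ofReal_re_of_nonneg hh, ← ofReal_re_of_nonneg hm] at hle
  have h3 : p.re ≤ (a.re + n.re) / (1 + h.re) * m.re := by exact_mod_cast hle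
  rwa [div_mul_eq_mul_div, le_div_iff₀ (by positivity)] at h3

/-- Testing subordination on `(I + Λ̂η|ₜ) ρ`, again positive, removes the inverse: the
representation of `η` returns `η(ρ)|ₜ` there, and evaluation at `T` gives `ρ(T) + η(ρ)|ₜ(Λ(T))`. -/
theorem trunc_subordinate_le_div (hT : 0 ≤ T) (hμ : IsPositiveWeight μ) (hη : IsQWeightMap η)
    (hs : QSubordinate η (rankOneMap (evalAt K T) μ)) {ρ : Predual K} (hρ : ρ.IsPositive)
    (t : Set.Ioi (0 : ℝ)) {A : HL K →L[ℂ] HL K} (hA : 0 ≤ A) :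
    (trunc t (η ρ)).1 A ≤ (ρ.1 T + (trunc t (η ρ)).1 (lam T)) / (1 + (trunc t μ).1 (lam T)) *
      (trunc t μ).1 A := by
  have hσ : (onePlus η t ρ).IsPositive := hρ.add
    (lamHat_isPositive (trunc_isPositive (hη.completelyPositive.map_isPositive hρ) t))
  have h1 := (hs t).map_isPositive hσ A hA
  rw [LinearMap.sub_apply, boundaryRep_apply_onePlus (hη.invertible t),
    boundaryRep_rankOneMap_evalAt hT hμ, Predual.sub_apply, Predual.smul_apply, sub_nonneg] at h1
  exact h1

theorem trunc_subordinate_le (hT : 0 ≤ T) (hμ : IsPositiveWeight μ) (hη : IsQWeightMap η)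
    (hs : QSubordinate η (rankOneMap (evalAt K T) μ)) {ρ : Predual K} (hρ : ρ.IsPositive)
    (t : Set.Ioi (0 : ℝ)) {A : HL K →L[ℂ] HL K} (hA : 0 ≤ A) :
    ((trunc t (η ρ)).1 A).re * (1 + ((trunc t μ).1 (lam T)).re) ≤
      ((ρ.1 T).re + ((trunc t (η ρ)).1 (lam T)).re) * ((trunc t μ).1 A).re :=
  have hν := hη.completelyPositive.map_isPositive hρ
  re_mul_le_of_le_div (trunc_isPositive hν t A hA) (trunc_lam_nonneg hT hν t) (hρ T hT)
    (trunc_lam_nonneg hT hμ t) (trunc_isPositive hμ t A hA)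
    (trunc_subordinate_le_div hT hμ hη hs hρ t hA)

/-- Here `p, n, n'` stand for `ν|ₜ` at `A`, `Λ(T)`, `Λ(I)`, and `m, h, l, i` for `μ|ₜ` at `A`,
`Λ(T)`, `Λ(I)`, `I`. From `l ≤ 1 + h` one gets `κ (1 + l) ≤ κ + a + n'`, and `ε` scales the excess
`κ + a` below `1`. -/
theorem mul_smul_le_of_factor {ε κ a h l i m n n' p : ℝ} (hε0 : 0 < ε) (hε1 : ε * (κ + a) ≤ 1)
    (hκ0 : 0 ≤ κ) (h1 : p ≤ κ * m) (h2 : κ * (1 + h) ≤ a + n) (h3 : n ≤ n') (h4 : l ≤ i)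
    (h5 : i ≤ 1 + h) (h6 : 0 ≤ m) (h7 : 0 ≤ l) : ε * p * (1 + l) ≤ (1 + ε * n') * m := by
  have h8 : κ * (1 + l) ≤ κ + a + n' := by
    have := mul_le_mul_of_nonneg_left (h4.trans h5) hκ0
    linarith
  have h9 : ε * (κ * (1 + l)) ≤ 1 + ε * n' := by
    have := mul_le_mul_of_nonneg_left h8 hε0.le
    linarith
  calc ε * p * (1 + l) ≤ ε * (κ * m) * (1 + l) := by gcongr
    _ = ε * (κ * (1 + l)) * m := by ring
    _ ≤ _ := by gcongr

theorem weightQDominates_smul_of_factor (hT : 0 ≤ T) (hT1 : ‖T‖ = 1) (hμ : IsPositiveWeight μ)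
    (hc : ∀ t, ((trunc t μ).1 1).re ≤ 1 + ((trunc t μ).1 (lam T)).re)
    {ν : boundaryWeights K} (hν : IsPositiveWeight ν) {ε κ a : ℝ} (hε0 : 0 < ε)
    (hε1 : ε * (κ + a) ≤ 1) (hκ0 : 0 ≤ κ)
    (hκ : ∀ t A, 0 ≤ A → ((trunc t ν).1 A).re ≤ κ * ((trunc t μ).1 A).re)
    (hκT : ∀ t, κ * (1 + ((trunc t μ).1 (lam T)).re) ≤ a + ((trunc t ν).1 (lam T)).re) :
    WeightQDominates μ ((ε : ℂ) • ν) := by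
  refine (weightQDominates_iff hμ (hν.smul hε0.le)).2 fun t A hA => ?_
  have hpm := trunc_isPositive hμ t
  have key := mul_smul_le_of_factor hε0 hε1 hκ0 (hκ t A hA) (hκT t)
    ((trunc_isPositive hν t).re_mono (lam_mono (le_one_of_norm_eq_one hT hT1)))
    (hpm.re_mono (lam_one_le_one (K := K))) (hc t) (hpm.re_nonneg hA)
    (hpm.re_nonneg (lam_nonneg (A := (1 : K →L[ℂ] K)) zero_le_one))
  rw [trunc_ofReal_smul_re, trunc_ofReal_smul_re]
  exact key

/-- A `q`-pure boundary weight is proportional to each positive weight that is dominated as in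
`exists_factor`. -/
theorem exists_eq_smul_of_factor (hT : 0 ≤ T) (hT1 : ‖T‖ = 1) (hμ : IsPositiveWeight μ)
    (hc : ∀ t, ((trunc t μ).1 1).re ≤ 1 + ((trunc t μ).1 (lam T)).re) (hp : IsQPureWeight μ)
    {ν : boundaryWeights K} (hν : IsPositiveWeight ν) {κ a : ℝ} (hκ0 : 0 ≤ κ) (ha : 0 ≤ a)
    (hκ : ∀ t A, 0 ≤ A → ((trunc t ν).1 A).re ≤ κ * ((trunc t μ).1 A).re)
    (hκT : ∀ t, κ * (1 + ((trunc t μ).1 (lam T)).re) ≤ a + ((trunc t ν).1 (lam T)).re) :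
    ∃ c : ℝ, 0 ≤ c ∧ ν = (c : ℂ) • μ := by
  obtain ⟨ε, hε0, hε1⟩ : ∃ ε : ℝ, 0 < ε ∧ ε * (κ + a) ≤ 1 := by
    refine ⟨(1 + κ + a)⁻¹, inv_pos.2 (by positivity), ?_⟩
    rw [inv_mul_le_iff₀ (by positivity)]
    linarith
  obtain ⟨c, h0, -, hcη⟩ := (isQPureWeight_iff hμ).1 hp _ (hν.smul hε0.le)
    (weightQDominates_smul_of_factor hT hT1 hμ hc hν hε0 hε1 hκ0 hκ hκT)
  have hεc : (ε : ℂ) ≠ 0 := by exact_mod_cast hε0.ne'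
  have e : (c : ℂ) = ε * ((c / ε : ℝ) : ℂ) := by
    push_cast
    field_simp
  exact ⟨c / ε, by positivity, weight_eq_smul_of_smul_eq hεc
    (hcη.trans (congrArg (fun z : ℂ => z • μ) e))⟩

theorem exists_smul_eq_of_subordinate (hT : 0 ≤ T) (hT1 : ‖T‖ = 1) (hμ : IsPositiveWeight μ)
    (hc : ∀ t, ((trunc t μ).1 1).re ≤ 1 + ((trunc t μ).1 (lam T)).re) (hp : IsQPureWeight μ)
    (hη : IsQWeightMap η) (hs : QSubordinate η (rankOneMap (evalAt K T) μ)) {ρ : Predual K}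
    (hρ : ρ.IsPositive) : ∃ c : ℝ, 0 ≤ c ∧ η ρ = (c : ℂ) • μ := by
  have hν := hη.completelyPositive.map_isPositive hρ
  obtain ⟨κ, hκ0, hκ, hκT⟩ := exists_factor hμ hν hT (hρ.re_nonneg hT)
    fun t A hA => trunc_subordinate_le hT hμ hη hs hρ t hA
  exact exists_eq_smul_of_factor hT hT1 hμ hc hp hν hκ0 (hρ.re_nonneg hT) hκ hκT

variable (η) in
/-- The functional `ρ ↦ η(ρ)(B) / b`. -/
def weightQuotient (B : boundaryAlgebra K) (b : ℂ) : Predual K →ₗ[ℂ] ℂ where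
  toFun ρ := b⁻¹ * (η ρ).1 B
  map_add' ρ σ := by
    have : (η (ρ + σ)).1 B = (η ρ).1 B + (η σ).1 B := by rw [map_add]; rfl
    rw [this, mul_add]
  map_smul' c ρ := by
    have : (η (c • ρ)).1 B = c * (η ρ).1 B := by rw [map_smul]; rfl
    rw [this, RingHom.id_apply, smul_eq_mul]; ring

/-- The proportionality constants are linear in `ρ` because they can be read off at one `B` with
`μ(B) ≠ 0`; agreement on positive functionals extends by linearity. -/
theorem eq_rankOneMap_of_subordinate (hT : 0 ≤ T) (hT1 : ‖T‖ = 1) (hμ : IsPositiveWeight μ)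
    (hμ0 : μ ≠ 0) (hc : ∀ t, ((trunc t μ).1 1).re ≤ 1 + ((trunc t μ).1 (lam T)).re)
    (hp : IsQPureWeight μ) (hη : IsQWeightMap η)
    (hs : QSubordinate η (rankOneMap (evalAt K T) μ)) :
    ∃ F : Predual K →ₗ[ℂ] ℂ, η = rankOneMap F μ ∧ ∀ ρ : Predual K, ρ.IsPositive → 0 ≤ F ρ := by
  obtain ⟨B, hB⟩ := exists_weight_apply_ne_zero hμ0
  have key : ∀ ρ : Predual K, ρ.IsPositive → ∃ c : ℝ, 0 ≤ c ∧ η ρ = (c : ℂ) • μ ∧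
      weightQuotient η B (μ.1 B) ρ = c := by
    intro ρ hρ
    obtain ⟨c, h0, h⟩ := exists_smul_eq_of_subordinate hT hT1 hμ hc hp hη hs hρ
    refine ⟨c, h0, h, ?_⟩
    have h1 : (η ρ).1 B = c * μ.1 B := congrArg (fun w : boundaryWeights K => w.1 B) h
    change (μ.1 B)⁻¹ * (η ρ).1 B = c
    rw [h1]
    field_simp
  refine ⟨weightQuotient η B (μ.1 B), eq_of_eq_on_isPositive fun ρ hρ => ?_, fun ρ hρ => ?_⟩
  · obtain ⟨c, -, h, h'⟩ := key ρ hρ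
    exact h.trans (congrArg (fun z : ℂ => z • μ) h'.symm)
  · obtain ⟨c, h0, -, h'⟩ := key ρ hρ
    rw [h']
    exact_mod_cast h0

/-! ### The operator behind a subordinate -/

theorem exists_trunc_one_pos (hμ : IsPositiveWeight μ) (hμ0 : μ ≠ 0) :
    ∃ t₀ : Set.Ioi (0 : ℝ), ∀ t ≤ t₀, 0 < ((trunc t μ).1 1).re := by
  obtain ⟨t₀, h0⟩ : ∃ t₀, 0 < ((trunc t₀ μ).1 1).re := by
    by_contra! h
    refine hμ0 (eq_of_trunc_eq fun t => ?_)
    rw [trunc_zero]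
    exact norm_le_zero_iff.1 ((trunc_isPositive hμ t).norm_le.trans (h t))
  exact ⟨t₀, fun t ht => h0.trans_le (trunc_re_antitone hμ zero_le_one (fun t => by
    rw [mul_one, one_mul]) ht)⟩

/-- Inserting `η(ρ) = F(ρ) μ` into the comparison at `A = I`, the `h` terms cancel; dividing by a
positive `μ|ₜ(I)` leaves `F(ρ) ≤ ρ(T)`. -/
theorem eq_evalAt_of_subordinate (hT : 0 ≤ T) (hμ : IsPositiveWeight μ) (hμ0 : μ ≠ 0)
    {F : Predual K →ₗ[ℂ] ℂ} (hF : ∀ ρ : Predual K, ρ.IsPositive → 0 ≤ F ρ)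
    (hη : IsQWeightMap (rankOneMap F μ))
    (hs : QSubordinate (rankOneMap F μ) (rankOneMap (evalAt K T) μ)) :
    ∃ D : K →L[ℂ] K, F = evalAt K D ∧ 0 ≤ D ∧ D ≤ T := by
  obtain ⟨t₀, ht₀⟩ := exists_trunc_one_pos hμ hμ0
  have hle : ∀ ρ : Predual K, ρ.IsPositive → F ρ ≤ ρ.1 T := by
    intro ρ hρ
    have h1 := trunc_subordinate_le hT hμ hη hs hρ t₀ zero_le_one
    have h2 := ht₀ t₀ le_rfl
    have h3 := ofReal_re_of_nonneg (hF ρ hρ)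
    rw [trunc_rankOneMap, Predual.smul_apply, Predual.smul_apply, ← h3, Complex.re_ofReal_mul,
      Complex.re_ofReal_mul] at h1
    rw [← h3, ← hρ.ofReal_re hT]
    generalize ((trunc t₀ μ).1 (lam T)).re = h at *
    generalize ((trunc t₀ μ).1 1).re = m at *
    have h4 : (F ρ).re * m ≤ (ρ.1 T).re * m := by linarith
    exact_mod_cast le_of_mul_le_mul_right h4 h2
  obtain ⟨D, rfl⟩ := exists_eq_evalAt F T hF hle
  refine ⟨D, rfl, (nonneg_iff_inner D).2 fun x => ?_, ?_⟩
  · simpa using hF _ (vectorFunctional_isPositive x)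
  · rw [← sub_nonneg, nonneg_iff_inner]
    intro x
    have := hle _ (vectorFunctional_isPositive x)
    rw [evalAt_apply, vectorFunctional_apply, vectorFunctional_apply] at this
    rw [sub_apply, inner_sub_right]
    exact sub_nonneg.2 this

/-- A converse to `qSubordinate_of_operator_le` at times with nonzero truncation: test on vector
functionals and at `I`. -/
theorem smul_operator_le_of_subordinate (hT : 0 ≤ T) (hμ : IsPositiveWeight μ) {D : K →L[ℂ] K}
    (hD : 0 ≤ D) (hs : QSubordinate (rankOneMap (evalAt K D) μ) (rankOneMap (evalAt K T) μ))
    {t : Set.Ioi (0 : ℝ)} (ht : 0 < ((trunc t μ).1 1).re) :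
    ((1 + ((trunc t μ).1 (lam T)).re : ℝ) : ℂ) • D ≤
      ((1 + ((trunc t μ).1 (lam D)).re : ℝ) : ℂ) • T := by
  rw [← sub_nonneg, nonneg_iff_inner]
  intro x
  have hx := vectorFunctional_isPositive x
  have hpm := trunc_isPositive hμ t
  have h1 := (hs t).map_isPositive hx 1 zero_le_one
  have h2 := hpm.re_nonneg (lam_nonneg hT)
  have h3 := hpm.re_nonneg (lam_nonneg hD)
  rw [LinearMap.sub_apply, boundaryRep_rankOneMap_evalAt hT hμ,
    boundaryRep_rankOneMap_evalAt hD hμ, Predual.sub_apply, Predual.smul_apply,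
    Predual.smul_apply, sub_nonneg, vectorFunctional_apply, vectorFunctional_apply,
    ← hpm.ofReal_re zero_le_one, ← hpm.ofReal_re (lam_nonneg hT),
    ← hpm.ofReal_re (lam_nonneg hD), ← ofReal_re_of_nonneg ((nonneg_iff_inner D).1 hD x),
    ← ofReal_re_of_nonneg ((nonneg_iff_inner T).1 hT x)] at h1
  rw [sub_apply, smul_apply, smul_apply, inner_sub_right, inner_smul_right, inner_smul_right,
    ← ofReal_re_of_nonneg ((nonneg_iff_inner D).1 hD x),
    ← ofReal_re_of_nonneg ((nonneg_iff_inner T).1 hT x), sub_nonneg]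
  generalize ((trunc t μ).1 (lam T)).re = h at *
  generalize ((trunc t μ).1 (lam D)).re = d at *
  generalize ((trunc t μ).1 1).re = m at *
  generalize (⟪x, D x⟫_ℂ).re = y at *
  generalize (⟪x, T x⟫_ℂ).re = z at *
  have h4 : y / (1 + d) * m ≤ z / (1 + h) * m := by exact_mod_cast h1
  have h5 := le_of_mul_le_mul_right h4 ht
  rw [div_le_div_iff₀ (by positivity) (by positivity)] at h5
  have h6 : (1 + h) * y ≤ (1 + d) * z := by linarith
  exact_mod_cast h6

theorem operator_eq_smul_of_subordinate (hT : IsStarProjection T) (hT1 : ‖T‖ = 1)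
    (hμ : IsPositiveWeight μ) (hμ0 : μ ≠ 0)
    (htop : 1 < LinearMap.rank (T : K →ₗ[ℂ] K) → ∀ e : K →L[ℂ] K, IsStarProjection e →
      LinearMap.rank (e : K →ₗ[ℂ] K) = 1 → e ≤ T → weightValue μ (lam e) = ⊤)
    {D : K →L[ℂ] K} (hD : 0 ≤ D) (hDT : D ≤ T)
    (hs : QSubordinate (rankOneMap (evalAt K D) μ) (rankOneMap (evalAt K T) μ)) :
    ∃ c : ℝ, 0 ≤ c ∧ c ≤ 1 ∧ D = (c : ℂ) • T := by
  have hT0 : T ≠ 0 := by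
    rintro rfl
    rw [norm_zero] at hT1
    exact zero_ne_one hT1
  rcases le_or_gt (LinearMap.rank (T : K →ₗ[ℂ] K)) 1 with hr | hr
  · exact exists_eq_smul_of_rank_le_one hT hT0 hr hD hDT
  have hd1 : ‖D‖ ≤ 1 := hT1 ▸ CStarAlgebra.norm_le_norm_of_nonneg_of_le hD hDT
  refine ⟨‖D‖, norm_nonneg D, hd1, ?_⟩
  by_contra hne
  set X : K →L[ℂ] K := ((‖D‖ : ℝ) : ℂ) • T - D with hX
  have hX0 : 0 ≤ X := sub_nonneg.2 (le_norm_smul_of_le_isStarProjection hT hD hDT)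
  have hTX : T * X = X := by
    rw [hX, mul_sub, mul_smul_comm, hT.isIdempotentElem.eq,
      (mul_eq_self_of_le_isStarProjection hT hD hDT).2]
  obtain ⟨e, k, he, he1, heT, hk, hek⟩ := exists_rankOne_projection_le hT hX0 hTX
    fun h => hne (sub_eq_zero.1 h).symm
  obtain ⟨t₀, ht₀⟩ := exists_trunc_one_pos hμ hμ0
  -- With `e ≤ k X` and `X = ‖D‖T - D`, the norm inequality `(1 + h) ‖D‖ ≤ 1 + d` gives `‖D‖ h - d ≤
  -- 1 - ‖D‖`, so `μ(Λ(e))` would be finite.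
  refine weightValue_ne_top_of_eventually_le (M := k * (1 - ‖D‖)) ?_ (htop hr e he he1 heT)
  filter_upwards [eventually_val_lt t₀.2] with t ht
  have hpm := trunc_isPositive hμ t
  have h1 := smul_operator_le_of_subordinate hT.nonneg hμ hD hs (ht₀ t (le_of_lt ht))
  have h2 := hpm.re_mono (lam_mono hek)
  rw [lam_ofReal_smul_re, hX, map_sub, Predual.map_sub, Complex.sub_re, lam_ofReal_smul_re] at h2
  have h3 := hpm.re_nonneg (lam_nonneg hT.nonneg)
  have h4 := hpm.re_nonneg (lam_nonneg hD)
  generalize ((trunc t μ).1 (lam T)).re = h at *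
  generalize ((trunc t μ).1 (lam D)).re = d at *
  have h5 := CStarAlgebra.norm_le_norm_of_nonneg_of_le
    (ofReal_smul_nonneg (by positivity) hD) h1
  rw [norm_smul, norm_smul, hT1, Complex.norm_of_nonneg (by positivity),
    Complex.norm_of_nonneg (by positivity), mul_one] at h5
  refine h2.trans (mul_le_mul_of_nonneg_left ?_ hk)
  linarith

theorem isQPure_rankOneMap (hT : IsStarProjection T) (hT1 : ‖T‖ = 1) (hμ : IsPositiveWeight μ)
    (hμ0 : μ ≠ 0) (hc : ∀ t, ((trunc t μ).1 1).re ≤ 1 + ((trunc t μ).1 (lam T)).re)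
    (hp : IsQPureWeight μ)
    (htop : 1 < LinearMap.rank (T : K →ₗ[ℂ] K) → ∀ e : K →L[ℂ] K, IsStarProjection e →
      LinearMap.rank (e : K →ₗ[ℂ] K) = 1 → e ≤ T → weightValue μ (lam e) = ⊤) :
    IsQPure (rankOneMap (evalAt K T) μ) := by
  rw [isQPure_iff_subordinates_eq_smul hT.nonneg hT1 hμ hc]
  intro η hη hs
  obtain ⟨F, rfl, hF⟩ := eq_rankOneMap_of_subordinate hT.nonneg hT1 hμ hμ0 hc hp hη hs
  obtain ⟨D, rfl, hD, hDT⟩ := eq_evalAt_of_subordinate hT.nonneg hμ hμ0 hF hη hs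
  obtain ⟨c, h0, h1, rfl⟩ := operator_eq_smul_of_subordinate hT hT1 hμ hμ0 htop hD hDT hs
  exact ⟨c, h0, h1, rfl⟩

end Backward

end QWeight

end

/-! ### The theorem -/

theorem mainTheorem1 {K : Type*} [NormedAddCommGroup K] [InnerProductSpace ℂ K] [CompleteSpace K]
    [TopologicalSpace.SeparableSpace K]
    (ω : BoundaryWeightMap K) (hω : IsQWeightMap ω) (hrank : HasRangeRank ω 1)
    (T : K →L[ℂ] K) (hT : 0 ≤ T) (hT1 : ‖T‖ = 1)
    (μ : boundaryWeights K) (hμ : IsPositiveWeight μ)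
    (hμT : weightValue μ (1 - lam T) ≤ 1)
    (hform : ∀ (ρ : Predual K) (A : boundaryAlgebra K), (ω ρ).1 A = ρ.1 T * μ.1 A) :
    IsQPure ω ↔
      IsStarProjection T ∧
      IsQPureWeight μ ∧
      (1 < LinearMap.rank (T : K →ₗ[ℂ] K) →
        ∀ e : K →L[ℂ] K, IsStarProjection e → LinearMap.rank (e : K →ₗ[ℂ] K) = 1 → e ≤ T →
          weightValue μ (lam e) = ⊤) := by
  -- A zero weight would give range rank zero.
  have hμ0 : μ ≠ 0 := by
    rintro rfl
    obtain ⟨W, hW, hW1⟩ := hrank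
    have hW0 : W = 0 := LinearMap.ext fun B => eq_of_predual_eq fun ρ => by
      rw [hW, hform]
      exact (mul_zero _).trans (Predual.map_zero ρ).symm
    rw [hW0, LinearMap.rank_zero] at hW1
    simp at hW1
  have hc := trunc_one_le hT hT1 hμ hμT
  obtain rfl : ω = rankOneMap (evalAt K T) μ :=
    LinearMap.ext fun ρ => Subtype.ext (LinearMap.ext fun A => hform ρ A)
  refine ⟨fun hp => ⟨isStarProjection_of_isQPure hT hT1 hμ hμ0 hc hp,
    isQPureWeight_of_isQPure hT hT1 hμ hc hp, fun hr e he he1 heT =>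
      weightValue_eq_top_of_isQPure hT hT1 hμ hμ0 hc hp hr he he1 heT⟩, ?_⟩
  rintro ⟨hproj, hp, htop⟩
  exact isQPure_rankOneMap hproj hT1 hμ hμ0 hc hp htop
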